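/- Let $M$ and $N$ be smooth manifolds without boundary of dimensions $m$ and $n$, where $m\ge n$ and $m-n$ is even, let $N$ be oriented ($M$ need not be orientable), and let $f\colon M\to N$ be a smooth map. A point $x\in M$ is *singular* if $\dim\ker d_xf\neq m-n$; $\Sigma(f)$ denotes the set of singular points. For $1\le r\le n$, a point $x$ is of *type $A_r$* if there are coordinates $(t_1,\dots,t_{n-r},\ell_2,\dots,\ell_r,x_1,\dots,x_{m-n+1})$ of $M$ centred at $x$ and coordinates $(T_1,\dots,T_{n-r},L_2,\dots,L_r,Z)$ of $N$ centred at $f(x)$ in which $f$ is given by $$T_i=t_i,\qquad L_i=\ell_i,\qquad Z=\pm x_1^2\pm\dots\pm x_{m-n}^2+\sum_{i=2}^{r}\ell_i\,x_{m-n+1}^{\,i-1}\pm x_{m-n+1}^{\,r+1}.$$ Points of type $A_1$ are called *fold points*, and $f$ is a *Morin map* if every singular point is of type $A_r$ for some $r\ge1$. At a fold point $x$ a *coorientation* is a choice of one of the two directions of the normal line $T_{f(x)}N/d_xf(T_xM)$ of the immersed fold locus; the *index* of $x$ with respect to it is the number of positive signs in the normal form above ($r=1$), in coordinates for which $\partial/\partial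 Z$ points in the direction of the coorientation. A coorientation is *canonical* if the index of $x$ with respect to it is odd. Suppose that $f$ is a Morin map. Then: 1. Every fold point has exactly one canonical coorientation. 2. $\Sigma(f)$ is a closed, smoothly embedded submanifold of $M$ of dimension $n-1$ (empty if $n=0$). 3. $\Sigma(f)$ has a canonical orientation: there is exactly one orientation of the whole manifold $\Sigma(f)$ such that, at every fold point $x$, for every basis $v_1,\dots,v_{n-1}$ of $T_x\Sigma(f)$ and every $\nu\in T_{f(x)}N$ in the direction of the canonical coorientation, the vectors $df(v_1),\dots,df(v_{n-1}),\nu$ form a basis of $T_{f(x)}N$, which is positively oriented in $N$ if and only if $v_1,\dots,v_{n-1}$ is positively oriented in $\Sigma(f)$. In particular, the orientation of the fold locus defined in this way extends across all other singular points. -/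

import Mathlib

open scoped Manifold ContDiff Topology

noncomputable section

namespace MorinMap

/-- `coord u i` is the `i`-th coordinate (counted from `0`) of `u ∈ ℝ^m`; it is only used for
`i < m`. -/
def coord {m : ℕ} (u : EuclideanSpace ℝ (Fin m)) (i : ℕ) : ℝ :=
  if h : i < m then u ⟨i, h⟩ else 0

/-- The last component `Z` of the normal form of an `A_r` singularity `ℝ^m → ℝ^n`, `1 ≤ r ≤ n ≤ m`.
The coordinates of the source, counted from `0`, are in this order
`t_1, …, t_{n-r}, ℓ_2, …, ℓ_r, x_1, …, x_{m-n}, x_{m-n+1}`, so that `ℓ_i` has position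
`n - r + (i - 2)`, the variables `x_1, …, x_{m-n}` have positions `n - 1, …, m - 2` and the last
variable `x = x_{m-n+1}` has position `m - 1`. With signs `ε`,
`Z = ∑ ± x_k ^ 2 + (ℓ_2 x + ℓ_3 x ^ 2 + ⋯ + ℓ_r x ^ (r - 1)) ± x ^ (r + 1)`. -/
def normalFormLast (m n r : ℕ) (ε : ℕ → ℤˣ) (u : EuclideanSpace ℝ (Fin m)) : ℝ :=
  ∑ k ∈ Finset.Ico (n - 1) (m - 1), ((ε k : ℤ) : ℝ) * coord u k ^ 2
    + ∑ i ∈ Finset.Icc 2 r, coord u (n - r + (i - 2)) * coord u (m - 1) ^ (i - 1)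
    + ((ε (m - 1) : ℤ) : ℝ) * coord u (m - 1) ^ (r + 1)

/-- The normal form of an `A_r` singularity: all target coordinates but the last are the
corresponding source coordinates (`T_i = t_i`, `L_i = ℓ_i`), the last one is `Z`. -/
def normalForm (m n r : ℕ) (ε : ℕ → ℤˣ) (u : EuclideanSpace ℝ (Fin m)) :
    EuclideanSpace ℝ (Fin n) :=
  WithLp.toLp 2 fun j : Fin n =>
    if (j : ℕ) < n - 1 then coord u j else normalFormLast m n r ε u

/-- For `r = 1` the last component is the nondegenerate quadratic form of a fold. -/
theorem normalFormLast_one {m n : ℕ} (hn : 1 ≤ n) (hnm : n ≤ m) (ε : ℕ → ℤˣ)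
    (u : EuclideanSpace ℝ (Fin m)) :
    normalFormLast m n 1 ε u =
      ∑ k ∈ Finset.Ico (n - 1) m, ((ε k : ℤ) : ℝ) * coord u k ^ 2 := by
  obtain ⟨m, rfl⟩ : ∃ k, m = k + 1 := ⟨m - 1, by omega⟩
  rw [Finset.sum_Ico_succ_top (by omega)]
  simp [normalFormLast]

section Maps

variable {m n : ℕ}
  {M : Type*} [TopologicalSpace M] [ChartedSpace (EuclideanSpace ℝ (Fin m)) M]
  {N : Type*} [TopologicalSpace N] [ChartedSpace (EuclideanSpace ℝ (Fin n)) N]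

variable (m n) in
/-- The set `Σ(f)` of singular points of a map of dimension `m - n`: the points at which the kernel
of the differential does not have dimension `m - n`. -/
def singularSet (f : M → N) : Set M :=
  {x | Module.finrank ℝ (LinearMap.ker (mfderiv (𝓡 m) (𝓡 n) f x).toLinearMap) ≠ m - n}

/-- `φ` (a chart of `M` centred at `x`) and `ψ` (a chart of `N` centred at `f x`) are coordinates
in which `f` is the normal form of an `A_r` singularity with signs `ε`. -/
structure IsNormalFormAt (f : M → N) (r : ℕ) (x : M)
    (φ : OpenPartialHomeomorph M (EuclideanSpace ℝ (Fin m)))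
    (ψ : OpenPartialHomeomorph N (EuclideanSpace ℝ (Fin n))) (ε : ℕ → ℤˣ) : Prop where
  source_chart : φ ∈ IsManifold.maximalAtlas (𝓡 m) ∞ M
  target_chart : ψ ∈ IsManifold.maximalAtlas (𝓡 n) ∞ N
  mem_source : x ∈ φ.source
  map_mem_source : f x ∈ ψ.source
  source_centred : φ x = 0
  target_centred : ψ (f x) = 0
  mapsTo : Set.MapsTo f φ.source ψ.source
  eq_normalForm : ∀ y ∈ φ.source, ψ (f y) = normalForm m n r ε (φ y)

variable (m n) in
/-- The set `A_r(f)` of singular points of type `A_r`; `A_1(f)` is the set of fold points,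
`A_2(f)` the set of cusps. -/
def singularType (r : ℕ) (f : M → N) : Set M :=
  {x | 1 ≤ r ∧ r ≤ n ∧
    ∃ (φ : OpenPartialHomeomorph M (EuclideanSpace ℝ (Fin m)))
      (ψ : OpenPartialHomeomorph N (EuclideanSpace ℝ (Fin n))) (ε : ℕ → ℤˣ),
      IsNormalFormAt f r x φ ψ ε}

variable (m n) in
/-- A Morin map is a smooth map all of whose singular points are of type `A_r` for some
`r ≥ 1`. -/
def IsMorinMap (f : M → N) : Prop :=
  ContMDiff (𝓡 m) (𝓡 n) ∞ f ∧ ∀ x ∈ singularSet m n f, ∃ r : ℕ, x ∈ singularType m n r f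

variable (m n) in
/-- The normal space at `f x` to the image of the differential of `f` at `x`. If `x` is a fold
point, then `f` immerses the fold locus near `x`, the tangent hyperplane of this sheet at `f x` is
the image of the differential of `f` at `x`, and this space is the normal line of the sheet. -/
abbrev NormalSpace (f : M → N) (x : M) : Type :=
  TangentSpace (𝓡 n) (f x) ⧸ LinearMap.range (mfderiv (𝓡 m) (𝓡 n) f x).toLinearMap

variable (m n) in
/-- A coorientation at (the image of) a fold point `x`: one of the two directions of the normal
line. -/
abbrev Coorientation (f : M → N) (x : M) : Type :=
  Module.Ray ℝ (NormalSpace m n f x)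

/-- The vector `ν` is transverse to the image of the differential of `f` at `x` and points in the
direction of the coorientation `c`. -/
def PointsAlong (f : M → N) (x : M) (c : Coorientation m n f x)
    (ν : TangentSpace (𝓡 n) (f x)) : Prop :=
  ∃ h : (Submodule.Quotient.mk ν : NormalSpace m n f x) ≠ 0, rayOfNeZero ℝ _ h = c

/-- `x` is a fold point of index `i` with respect to the coorientation `c`: in suitable coordinates
`f` is `(x_1, …, x_m) ↦ (x_1, …, x_{n-1}, ± x_n ^ 2 ± ⋯ ± x_m ^ 2)` near `x` with exactly `i`
positive signs, and the last coordinate vector `∂/∂Z` at `f x` points in the direction of `c`. -/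
def HasFoldIndex (f : M → N) (x : M) (c : Coorientation m n f x) (i : ℕ) : Prop :=
  1 ≤ n ∧
    ∃ (φ : OpenPartialHomeomorph M (EuclideanSpace ℝ (Fin m)))
      (ψ : OpenPartialHomeomorph N (EuclideanSpace ℝ (Fin n))) (ε : ℕ → ℤˣ),
      IsNormalFormAt f 1 x φ ψ ε ∧
      ((Finset.Ico (n - 1) m).filter fun k => ε k = 1).card = i ∧
      ∃ ν : TangentSpace (𝓡 n) (f x),
        mfderiv (𝓡 n) (𝓡 n) ψ (f x) ν =
          (WithLp.toLp 2 fun j : Fin n => if (j : ℕ) = n - 1 then (1 : ℝ) else 0) ∧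
        PointsAlong f x c ν

/-- The coorientation `c` at the fold point `x` is canonical: the index of `x` with respect to `c`
is odd. -/
def IsCanonicalCoorientation (f : M → N) (x : M) (c : Coorientation m n f x) : Prop :=
  ∃ i : ℕ, Odd i ∧ HasFoldIndex f x c i

end Maps

/-- An orientation of a smooth `d`-manifold `X` without boundary: a choice of an orientation of
every tangent space which is locally constant in charts. (A point of a `0`-manifold has the two
orientations `+` and `-`.) -/
def IsOrientation {d : ℕ} {X : Type*} [TopologicalSpace X]
    [ChartedSpace (EuclideanSpace ℝ (Fin d)) X]
    (o : ∀ x : X, Orientation ℝ (TangentSpace (𝓡 d) x) (Fin d)) : Prop :=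
  ∀ x₀ : X, ∃ φ ∈ IsManifold.maximalAtlas (𝓡 d) ∞ X, x₀ ∈ φ.source ∧
    ∃ o₀ : Orientation ℝ (EuclideanSpace ℝ (Fin d)) (Fin d), ∀ x ∈ φ.source,
      ∃ L : TangentSpace (𝓡 d) x ≃ₗ[ℝ] EuclideanSpace ℝ (Fin d),
        (∀ v, L v = mfderiv (𝓡 d) (𝓡 d) φ x v) ∧ Orientation.map (Fin d) L (o x) = o₀

/-- Compatibility, at the fold point `x` of `f`, of an orientation `a` of the tangent space of
`Σ(f)` with an orientation `b` of the tangent space of `N`, for a smooth structure on `Σ(f)`: for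
every basis `v_1, …, v_{n-1}` of the tangent space of `Σ(f)` at `x` and every vector `ν` in the
direction of a canonical coorientation, the images of `v_1, …, v_{n-1}` under the differential of
`f|Σ(f)` followed by `ν` form a basis of the tangent space of `N`, and this basis is positive for
`b` if and only if `v_1, …, v_{n-1}` is positive for `a`. -/
def IsCanonicallyOrientedAt {m n : ℕ}
    {M : Type*} [TopologicalSpace M] [ChartedSpace (EuclideanSpace ℝ (Fin m)) M]
    {N : Type*} [TopologicalSpace N] [ChartedSpace (EuclideanSpace ℝ (Fin n)) N]
    (f : M → N) [ChartedSpace (EuclideanSpace ℝ (Fin (n - 1))) (singularSet m n f)]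
    (x : singularSet m n f)
    (a : Orientation ℝ (TangentSpace (𝓡 (n - 1)) x) (Fin (n - 1)))
    (b : Orientation ℝ (TangentSpace (𝓡 n) (f x)) (Fin n)) : Prop :=
  ∀ c : Coorientation m n f x, IsCanonicalCoorientation f (x : M) c →
    ∀ ν : TangentSpace (𝓡 n) (f x), PointsAlong f (x : M) c ν →
      ∀ v : Module.Basis (Fin (n - 1)) ℝ (TangentSpace (𝓡 (n - 1)) x),
        ∃ w : Module.Basis (Fin n) ℝ (TangentSpace (𝓡 n) (f x)),
          (∀ j : Fin n, w j =
            if h : (j : ℕ) < n - 1 then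
              mfderiv (𝓡 (n - 1)) (𝓡 n) (fun p : singularSet m n f => f p) x (v ⟨j, h⟩)
            else ν) ∧
          (w.orientation = b ↔ v.orientation = a)

end MorinMap

end

/-!
Near a point of type `A_r` the map `f` is the normal form `normalForm m n r ε`, and everything is
read off from it. Its singular points are the points at which `Z` is critical in the fibre variables
`x_1, …, x_{m-n+1}`, that is `x_1 = ⋯ = x_{m-n} = 0` and `∂Z/∂x = 0`, where `x = x_{m-n+1}`.
For `r ≥ 2` the derivative `∂Z/∂x` is `ℓ_2` plus a function of the other coordinates, so exchanging
`ℓ_2` for `∂Z/∂x` straightens the singular set (`exists_straightening`), and slice charts make it a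
submanifold (`exists_isSmoothEmbedding_of_isSliceChart`).

At a singular point the Hessian on the kernel of the differential with values in the cokernel, the
second intrinsic derivative, does not depend on coordinates. In a normal form it is diagonal with
entries `± 2` and `κ = ∂²Z/∂x²`. Hence two normal forms that overlap at a singular point have
proportional conormal functionals, and the signatures of their Hessians agree or are interchanged
according to the sign of the factor (`IsNormalFormAt.compare`). In particular `κ ≠ 0` exactly at the
fold points, and the index of a fold with respect to a coorientation is well defined. The indices
with respect to the two coorientations add up to the odd number `m - n + 1`, so that exactly one of
them is odd (`existsUnique_canonicalCoorientation`).

For the orientation, fix a normal form and let `λ` be the value of its conormal functional on a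
vector in the canonical direction. The index in the direction of `∂/∂Z` is a constant plus `1` if
`κ > 0`, so the sign of `λ κ` is constant over all fold points in the chart. On the other hand, the
Jacobian `δ` of the restriction of the first `n - 1` components of `f` to the singular set is a
constant multiple of `κ`, because the singular set is the graph of `ℓ_2 = -(∂Z/∂x - ℓ_2)` and `x` is
one of its coordinates. So the sign of `λ δ` is constant, and this is the sign that compares the
frame `df(v_1), …, df(v_{n-1}), ν` with the frame `v_1, …, v_{n-1}`
(`stdBasis_det_fderiv_normalForm`, `IsNormalFormAt.isCanonicallyOrientedAt`): the fold sheets on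
both sides of a higher singularity get the restriction of one orientation. As the fold points are
dense in the singular set (`dense_lastPartial₂_ne_zero`), the local orientations determine a unique
global one (`existsUnique_isOrientation`).
-/

noncomputable section

namespace MorinMap

/-! ### Coordinates and the derivatives of the normal form -/

/-- `coord · i` as a continuous linear functional; it vanishes for `i ≥ m`. -/
def coordCLM (m i : ℕ) : EuclideanSpace ℝ (Fin m) →L[ℝ] ℝ :=
  if h : i < m then EuclideanSpace.proj ⟨i, h⟩ else 0

@[simp] theorem coordCLM_apply {m : ℕ} (i : ℕ) (u : EuclideanSpace ℝ (Fin m)) :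
    coordCLM m i u = coord u i := by
  unfold coordCLM coord
  split_ifs <;> simp

theorem coord_of_lt {m : ℕ} (u : EuclideanSpace ℝ (Fin m)) {i : ℕ} (h : i < m) :
    coord u i = u ⟨i, h⟩ := dif_pos h

@[simp] theorem coord_val {m : ℕ} (u : EuclideanSpace ℝ (Fin m)) (i : Fin m) :
    coord u i = u i := coord_of_lt u i.2

@[simp] theorem coord_add {m : ℕ} (u v : EuclideanSpace ℝ (Fin m)) (i : ℕ) :
    coord (u + v) i = coord u i + coord v i := by
  simp only [← coordCLM_apply, map_add]

@[simp] theorem coord_smul {m : ℕ} (c : ℝ) (u : EuclideanSpace ℝ (Fin m)) (i : ℕ) :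
    coord (c • u) i = c * coord u i := by
  simp only [← coordCLM_apply, map_smul, smul_eq_mul]

@[simp] theorem coord_zero {m : ℕ} (i : ℕ) : coord (0 : EuclideanSpace ℝ (Fin m)) i = 0 := by
  simp only [← coordCLM_apply, map_zero]

theorem contDiff_coord {m : ℕ} {k : ℕ∞ω} (i : ℕ) :
    ContDiff ℝ k fun u : EuclideanSpace ℝ (Fin m) => coord u i := by
  have h : ContDiff ℝ k fun u => coordCLM m i u := (coordCLM m i).contDiff
  simpa only [coordCLM_apply] using h

/-- The vector of `ℝ^d` whose coordinates are the values of a function on `ℕ`. -/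
def ofCoords (d : ℕ) (a : ℕ → ℝ) : EuclideanSpace ℝ (Fin d) := WithLp.toLp 2 fun i => a i

@[simp] theorem ofCoords_apply {d : ℕ} (a : ℕ → ℝ) (i : Fin d) : ofCoords d a i = a i := rfl

theorem coord_ofCoords {d : ℕ} (a : ℕ → ℝ) {i : ℕ} (h : i < d) : coord (ofCoords d a) i = a i := by
  rw [coord_of_lt _ h]; rfl

theorem ext_coord {d : ℕ} {u v : EuclideanSpace ℝ (Fin d)} (h : ∀ i < d, coord u i = coord v i) :
    u = v := by
  ext i
  simpa using h i i.2

theorem contDiff_ofCoords {d : ℕ} {E : Type*} [NormedAddCommGroup E] [NormedSpace ℝ E] {k : ℕ∞ω}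
    {a : E → ℕ → ℝ} (h : ∀ i < d, ContDiff ℝ k fun u => a u i) :
    ContDiff ℝ k fun u => ofCoords d (a u) := by
  rw [contDiff_euclidean]
  exact fun i => h i i.2

theorem hasDerivAt_comp_line {E F : Type*} [NormedAddCommGroup E] [NormedSpace ℝ E]
    [NormedAddCommGroup F] [NormedSpace ℝ F] {G : E → F} {u : E} (v : E)
    (h : DifferentiableAt ℝ G u) :
    HasDerivAt (fun s : ℝ => G (u + s • v)) (fderiv ℝ G u v) 0 := by
  have h1 : HasDerivAt (fun s : ℝ => u + s • v) v 0 := by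
    simpa using ((hasDerivAt_id (0 : ℝ)).smul_const v).const_add u
  have h2 : HasFDerivAt G (fderiv ℝ G u) (u + (0 : ℝ) • v) := by
    simpa using h.hasFDerivAt
  exact h2.comp_hasDerivAt (0 : ℝ) h1

theorem hasDerivAt_clm_line {E F : Type*} [NormedAddCommGroup E] [NormedSpace ℝ E]
    [NormedAddCommGroup F] [NormedSpace ℝ F] {G : E → E →L[ℝ] F} {u : E} (v w : E)
    (h : DifferentiableAt ℝ G u) :
    HasDerivAt (fun s : ℝ => G (u + s • v) w) (fderiv ℝ G u v w) 0 :=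
  ((ContinuousLinearMap.apply ℝ F w).hasFDerivAt.comp_hasDerivAt (0 : ℝ)
    (hasDerivAt_comp_line v h))

section Calculus

variable (m n r : ℕ) (ε : ℕ → ℤˣ)

/-- The partial derivative `∂Z/∂x` of the last component of the normal form with respect to the
last source coordinate `x`. -/
def lastPartial (u : EuclideanSpace ℝ (Fin m)) : ℝ :=
  ∑ i ∈ Finset.Icc 2 r, coord u (n - r + (i - 2)) * (((i - 1 : ℕ) : ℝ) * coord u (m - 1) ^ (i - 2))
    + ((ε (m - 1) : ℤ) : ℝ) * (((r + 1 : ℕ) : ℝ) * coord u (m - 1) ^ r)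

/-- The second partial derivative `∂²Z/∂x²` of the last component of the normal form with respect
to the last source coordinate `x`. -/
def lastPartial₂ (u : EuclideanSpace ℝ (Fin m)) : ℝ :=
  ∑ i ∈ Finset.Icc 2 r, coord u (n - r + (i - 2)) *
      (((i - 1 : ℕ) : ℝ) * (((i - 2 : ℕ) : ℝ) * coord u (m - 1) ^ (i - 2 - 1)))
    + ((ε (m - 1) : ℤ) : ℝ) * (((r + 1 : ℕ) : ℝ) * ((r : ℝ) * coord u (m - 1) ^ (r - 1)))

/-- At a critical point, the Hessian of `Z` in the fibre coordinates `x_1, …, x_{m-n+1}` is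
diagonal; this is the diagonal entry in the direction of the coordinate with position `k`. -/
def hessWeight (u : EuclideanSpace ℝ (Fin m)) (k : ℕ) : ℝ :=
  if k = m - 1 then lastPartial₂ m n r ε u else 2 * ((ε k : ℤ) : ℝ)

variable {m n r ε}

theorem contDiff_normalFormLast {k : ℕ∞ω} : ContDiff ℝ k (normalFormLast m n r ε) := by
  unfold normalFormLast
  refine ((ContDiff.sum fun i _ => ?_).add (ContDiff.sum fun i _ => ?_)).add ?_
  · exact contDiff_const.mul ((contDiff_coord i).pow 2)
  · exact (contDiff_coord _).mul ((contDiff_coord _).pow _)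
  · exact contDiff_const.mul ((contDiff_coord _).pow _)

theorem contDiff_lastPartial {k : ℕ∞ω} : ContDiff ℝ k (lastPartial m n r ε) := by
  unfold lastPartial
  refine (ContDiff.sum fun i _ => ?_).add ?_
  · exact (contDiff_coord _).mul (contDiff_const.mul ((contDiff_coord _).pow _))
  · exact contDiff_const.mul (contDiff_const.mul ((contDiff_coord _).pow _))

/-- The vectors of `ℝ^m` whose first `n - 1` coordinates vanish. -/
def fibreSpace (m n : ℕ) : Submodule ℝ (EuclideanSpace ℝ (Fin m)) where
  carrier := {v | ∀ j < n - 1, coord v j = 0}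
  add_mem' := fun ha hb j hj => by simp [ha j hj, hb j hj]
  zero_mem' := fun j _ => by simp
  smul_mem' := fun c v hv j hj => by simp [hv j hj]

theorem hasDerivAt_coord_line (u v : EuclideanSpace ℝ (Fin m)) (i : ℕ) (t : ℝ) :
    HasDerivAt (fun s : ℝ => coord (u + s • v) i) (coord v i) t := by
  simpa using ((hasDerivAt_id t).mul_const (coord v i)).const_add (coord u i)

theorem fderiv_normalFormLast (hr : 1 ≤ r) (hrn : r ≤ n) {v : EuclideanSpace ℝ (Fin m)}
    (hv : v ∈ fibreSpace m n) (u : EuclideanSpace ℝ (Fin m)) :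
    fderiv ℝ (normalFormLast m n r ε) u v =
      ∑ k ∈ Finset.Ico (n - 1) (m - 1), 2 * ((ε k : ℤ) : ℝ) * coord u k * coord v k
        + lastPartial m n r ε u * coord v (m - 1) := by
  have hd : DifferentiableAt ℝ (normalFormLast m n r ε) u :=
    contDiff_normalFormLast.differentiable (n := 1) (by simp) _
  refine (hasDerivAt_comp_line v hd).unique ?_
  have hx := hasDerivAt_coord_line u v (m - 1) 0
  have hconst : ∀ i ∈ Finset.Icc 2 r, coord v (n - r + (i - 2)) = 0 := fun i hi => by
    rw [Finset.mem_Icc] at hi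
    exact hv _ (by omega)
  have h2 := (HasDerivAt.fun_sum (u := Finset.Ico (n - 1) (m - 1)) fun k _ =>
      ((hasDerivAt_coord_line u v k 0).fun_pow 2).const_mul ((ε k : ℤ) : ℝ)).add
    (HasDerivAt.fun_sum (u := Finset.Icc 2 r) fun i _ =>
      (hasDerivAt_coord_line u v (n - r + (i - 2)) 0).mul (hx.fun_pow (i - 1)))
  have h3 := h2.add ((hx.fun_pow (r + 1)).const_mul ((ε (m - 1) : ℤ) : ℝ))
  refine h3.congr_deriv ?_
  unfold lastPartial
  simp only [zero_smul, add_zero]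
  rw [add_mul, Finset.sum_mul, ← add_assoc]
  congr 1
  · congr 1
    · exact Finset.sum_congr rfl fun k _ => by norm_num; ring
    · refine Finset.sum_congr rfl fun i hi => ?_
      rw [hconst i hi]
      simp only [show i - 1 - 1 = i - 2 by omega]
      ring
  · simp only [show r + 1 - 1 = r by omega]
    ring

theorem hasDerivAt_lastPartial (hrn : r ≤ n) {v : EuclideanSpace ℝ (Fin m)}
    (hv : v ∈ fibreSpace m n) (u : EuclideanSpace ℝ (Fin m)) :
    HasDerivAt (fun s : ℝ => lastPartial m n r ε (u + s • v))
      (lastPartial₂ m n r ε u * coord v (m - 1)) 0 := by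
  have hx := hasDerivAt_coord_line u v (m - 1) 0
  have hconst : ∀ i ∈ Finset.Icc 2 r, coord v (n - r + (i - 2)) = 0 := fun i hi => by
    rw [Finset.mem_Icc] at hi
    exact hv _ (by omega)
  have h2 := (HasDerivAt.fun_sum (u := Finset.Icc 2 r) fun i _ =>
      (hasDerivAt_coord_line u v (n - r + (i - 2)) 0).mul
        ((hx.fun_pow (i - 2)).const_mul ((i - 1 : ℕ) : ℝ))).add
    (((hx.fun_pow r).const_mul ((r + 1 : ℕ) : ℝ)).const_mul ((ε (m - 1) : ℤ) : ℝ))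
  refine h2.congr_deriv ?_
  unfold lastPartial₂
  simp only [zero_smul, add_zero]
  rw [add_mul, Finset.sum_mul]
  congr 1
  · refine Finset.sum_congr rfl fun i hi => ?_
    rw [hconst i hi]
    ring
  · ring

theorem fderiv_fderiv_normalFormLast (hr : 1 ≤ r) (hrn : r ≤ n) (hnm : n ≤ m)
    {v : EuclideanSpace ℝ (Fin m)} (hv : v ∈ fibreSpace m n) (u : EuclideanSpace ℝ (Fin m)) :
    fderiv ℝ (fderiv ℝ (normalFormLast m n r ε)) u v v =
      ∑ k ∈ Finset.Ico (n - 1) m, hessWeight m n r ε u k * coord v k ^ 2 := by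
  have hd : DifferentiableAt ℝ (fderiv ℝ (normalFormLast m n r ε)) u :=
    (contDiff_normalFormLast.fderiv_right (m := 1) (n := 2) (by norm_num)).differentiable
      (by simp) _
  refine (hasDerivAt_clm_line v v hd).unique ?_
  simp only [fderiv_normalFormLast hr hrn hv]
  have h2 := (HasDerivAt.fun_sum (u := Finset.Ico (n - 1) (m - 1)) fun k _ =>
      ((hasDerivAt_coord_line u v k 0).const_mul (2 * ((ε k : ℤ) : ℝ))).mul_const (coord v k)).add
    ((hasDerivAt_lastPartial (ε := ε) hrn hv u).mul_const (coord v (m - 1)))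
  refine h2.congr_deriv ?_
  obtain ⟨M, rfl⟩ : ∃ M, m = M + 1 := ⟨m - 1, by omega⟩
  rw [Finset.sum_Ico_succ_top (by omega)]
  congr 1
  · refine Finset.sum_congr rfl fun k hk => ?_
    rw [Finset.mem_Ico] at hk
    rw [hessWeight, if_neg (by omega)]
    ring
  · rw [hessWeight, if_pos (by omega)]
    simp only [Nat.add_sub_cancel]
    ring

variable (m n r ε) in
/-- The differential of `Z` vanishes on the fibre directions: `u` is a singular point of the normal
form. -/
def IsCritical (u : EuclideanSpace ℝ (Fin m)) : Prop :=
  ∀ v ∈ fibreSpace m n, fderiv ℝ (normalFormLast m n r ε) u v = 0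

theorem isCritical_iff (hr : 1 ≤ r) (hrn : r ≤ n) (hnm : n ≤ m) {u : EuclideanSpace ℝ (Fin m)} :
    IsCritical m n r ε u ↔
      (∀ k ∈ Finset.Ico (n - 1) (m - 1), coord u k = 0) ∧ lastPartial m n r ε u = 0 := by
  constructor
  · intro h
    have key : ∀ k ∈ Finset.Ico (n - 1) m,
        (ofCoords m fun j => if j = k then (1 : ℝ) else 0) ∈ fibreSpace m n := by
      intro k hk j hj
      rw [Finset.mem_Ico] at hk
      rw [coord_ofCoords _ (by omega), if_neg (by omega)]
    constructor
    · intro k hk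
      have hk' := Finset.mem_Ico.1 hk
      have h1 := h _ (key k (Finset.mem_Ico.2 ⟨hk'.1, by omega⟩))
      rw [fderiv_normalFormLast hr hrn (key k (Finset.mem_Ico.2 ⟨hk'.1, by omega⟩)),
        coord_ofCoords _ (by omega), if_neg (by omega), mul_zero, add_zero,
        Finset.sum_eq_single_of_mem k hk, coord_ofCoords _ (by omega), if_pos rfl] at h1
      · rcases Int.units_eq_one_or (ε k) with h2 | h2 <;> simpa [h2] using h1
      · intro j hj hjk
        rw [Finset.mem_Ico] at hj
        rw [coord_ofCoords _ (by omega), if_neg hjk, mul_zero]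
    · have hk : m - 1 ∈ Finset.Ico (n - 1) m := Finset.mem_Ico.2 ⟨by omega, by omega⟩
      have h1 := h _ (key _ hk)
      rw [fderiv_normalFormLast hr hrn (key _ hk), Finset.sum_eq_zero, zero_add,
        coord_ofCoords _ (by omega), if_pos rfl, mul_one] at h1
      · exact h1
      · intro j hj
        rw [Finset.mem_Ico] at hj
        rw [coord_ofCoords _ (by omega), if_neg (by omega), mul_zero]
  · rintro ⟨h1, h2⟩ v hv
    rw [fderiv_normalFormLast hr hrn hv, h2, zero_mul, add_zero]
    exact Finset.sum_eq_zero fun k hk => by rw [h1 k hk]; ring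

theorem lastPartial_zero (hr : 1 ≤ r) : lastPartial m n r ε 0 = 0 := by
  simp [lastPartial, show r ≠ 0 by omega]

theorem isCritical_zero (hr : 1 ≤ r) (hrn : r ≤ n) (hnm : n ≤ m) : IsCritical m n r ε 0 :=
  (isCritical_iff hr hrn hnm).2 ⟨fun _ _ => coord_zero _, lastPartial_zero hr⟩

theorem lastPartial₂_one (u : EuclideanSpace ℝ (Fin m)) :
    lastPartial₂ m n 1 ε u = 2 * ((ε (m - 1) : ℤ) : ℝ) := by
  simp only [lastPartial₂, show Finset.Icc 2 1 = ∅ by decide, Finset.sum_empty]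
  norm_num
  ring

theorem lastPartial₂_zero (hr : 2 ≤ r) : lastPartial₂ m n r ε 0 = 0 := by
  simp [lastPartial₂, show r - 1 ≠ 0 by omega]

theorem hessWeight_one (u : EuclideanSpace ℝ (Fin m)) (k : ℕ) :
    hessWeight m n 1 ε u k = 2 * ((ε k : ℤ) : ℝ) := by
  unfold hessWeight
  split_ifs with h
  · rw [lastPartial₂_one, h]
  · rfl

end Calculus


/-! ### The differential of the normal form -/

section Differential

variable (m n r : ℕ) (ε : ℕ → ℤˣ)

/-- The linear map `ℝ^m → ℝ^n` which keeps the first `n - 1` coordinates and makes the others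
zero. -/
def trunc : EuclideanSpace ℝ (Fin m) →L[ℝ] EuclideanSpace ℝ (Fin n) :=
  LinearMap.toContinuousLinearMap
    { toFun := fun u => ofCoords n fun j => if j < n - 1 then coord u j else 0
      map_add' := fun u v => by ext i; by_cases h : (i : ℕ) < n - 1 <;> simp [h]
      map_smul' := fun c u => by ext i; by_cases h : (i : ℕ) < n - 1 <;> simp [h] }

/-- The linear map `ℝ^n → ℝ^m` which keeps the first `n - 1` coordinates and makes the others
zero. -/
def pad : EuclideanSpace ℝ (Fin n) →L[ℝ] EuclideanSpace ℝ (Fin m) :=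
  LinearMap.toContinuousLinearMap
    { toFun := fun u => ofCoords m fun j => if j < n - 1 then coord u j else 0
      map_add' := fun u v => by ext i; by_cases h : (i : ℕ) < n - 1 <;> simp [h]
      map_smul' := fun c u => by ext i; by_cases h : (i : ℕ) < n - 1 <;> simp [h] }

/-- The last basis vector `∂/∂Z` of `ℝ^n`. -/
def lastVec : EuclideanSpace ℝ (Fin n) :=
  WithLp.toLp 2 fun j : Fin n => if (j : ℕ) = n - 1 then (1 : ℝ) else 0

variable {m n r ε}

theorem trunc_apply (u : EuclideanSpace ℝ (Fin m)) :
    trunc m n u = ofCoords n fun j => if j < n - 1 then coord u j else 0 := rfl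

theorem pad_apply (u : EuclideanSpace ℝ (Fin n)) :
    pad m n u = ofCoords m fun j => if j < n - 1 then coord u j else 0 := rfl

theorem coord_trunc {j : ℕ} (hj : j < n - 1) (u : EuclideanSpace ℝ (Fin m)) :
    coord (trunc m n u) j = coord u j := by
  rw [trunc_apply, coord_ofCoords _ (by omega), if_pos hj]

theorem coord_trunc_last (u : EuclideanSpace ℝ (Fin m)) : coord (trunc m n u) (n - 1) = 0 := by
  by_cases h : n - 1 < n
  · rw [trunc_apply, coord_ofCoords _ h, if_neg (by omega)]
  · exact dif_neg h

theorem coord_pad (hnm : n ≤ m) {j : ℕ} (hj : j < n - 1) (u : EuclideanSpace ℝ (Fin n)) :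
    coord (pad m n u) j = coord u j := by
  rw [pad_apply, coord_ofCoords _ (by omega), if_pos hj]

theorem coord_lastVec {j : ℕ} (hj : j < n - 1) : coord (lastVec n) j = 0 := by
  rw [coord_of_lt _ (by omega)]
  simp [lastVec, hj.ne]

theorem coord_lastVec_last (hn : 1 ≤ n) : coord (lastVec n) (n - 1) = 1 := by
  rw [coord_of_lt _ (by omega)]
  simp [lastVec]

theorem ext_coord_last {u v : EuclideanSpace ℝ (Fin n)} (h : ∀ j < n - 1, coord u j = coord v j)
    (h' : coord u (n - 1) = coord v (n - 1)) : u = v := by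
  refine ext_coord fun i hi => ?_
  rcases (show i < n - 1 ∨ i = n - 1 by omega) with h1 | rfl
  exacts [h i h1, h']

theorem normalForm_eq (u : EuclideanSpace ℝ (Fin m)) :
    normalForm m n r ε u = trunc m n u + normalFormLast m n r ε u • lastVec n := by
  ext j
  by_cases h : (j : ℕ) < n - 1
  · simp [normalForm, trunc_apply, lastVec, h, h.ne]
  · simp [normalForm, trunc_apply, lastVec, show (j : ℕ) = n - 1 by omega]

theorem contDiff_normalForm {k : ℕ∞ω} : ContDiff ℝ k (normalForm m n r ε) := by
  simp only [funext normalForm_eq]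
  exact (trunc m n).contDiff.add (contDiff_normalFormLast.smul contDiff_const)

theorem differentiableAt_normalFormLast (u : EuclideanSpace ℝ (Fin m)) :
    DifferentiableAt ℝ (normalFormLast m n r ε) u :=
  contDiff_normalFormLast.differentiable (n := 1) (by simp) _

theorem fderiv_normalForm_eq (u : EuclideanSpace ℝ (Fin m)) :
    fderiv ℝ (normalForm m n r ε) u =
      trunc m n + (fderiv ℝ (normalFormLast m n r ε) u).smulRight (lastVec n) := by
  rw [funext normalForm_eq]
  exact ((trunc m n).hasFDerivAt.add
    ((differentiableAt_normalFormLast u).hasFDerivAt.smul_const (lastVec n))).fderiv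

theorem fderiv_normalForm (u v : EuclideanSpace ℝ (Fin m)) :
    fderiv ℝ (normalForm m n r ε) u v =
      trunc m n v + fderiv ℝ (normalFormLast m n r ε) u v • lastVec n := by
  simp [fderiv_normalForm_eq]

theorem fderiv_fderiv_normalForm (u v w : EuclideanSpace ℝ (Fin m)) :
    fderiv ℝ (fderiv ℝ (normalForm m n r ε)) u v w =
      fderiv ℝ (fderiv ℝ (normalFormLast m n r ε)) u v w • lastVec n := by
  have hd : DifferentiableAt ℝ (fderiv ℝ (normalFormLast m n r ε)) u :=
    (contDiff_normalFormLast.fderiv_right (m := 1) (n := 2) (by norm_num)).differentiable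
      (by simp) _
  have h := hasDerivAt_clm_line v w hd
  have h' : HasDerivAt (fun s : ℝ => fderiv ℝ (normalForm m n r ε) (u + s • v) w)
      (fderiv ℝ (fderiv ℝ (normalForm m n r ε)) u v w) 0 :=
    hasDerivAt_clm_line v w ((contDiff_normalForm.fderiv_right (m := 1) (n := 2)
      (by norm_num)).differentiable (by simp) _)
  simp only [fderiv_normalForm] at h'
  exact h'.unique ((h.smul_const (lastVec n)).const_add _)

variable (m n r ε) in
/-- At a singular point `u` of the normal form, a linear functional on `ℝ^n` whose kernel is the
image of the differential and which takes the value `1` at `∂/∂Z`. -/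
def conormal (u : EuclideanSpace ℝ (Fin m)) : EuclideanSpace ℝ (Fin n) →L[ℝ] ℝ :=
  coordCLM n (n - 1) - (fderiv ℝ (normalFormLast m n r ε) u).comp (pad m n)

theorem conormal_apply (u : EuclideanSpace ℝ (Fin m)) (T : EuclideanSpace ℝ (Fin n)) :
    conormal m n r ε u T =
      coord T (n - 1) - fderiv ℝ (normalFormLast m n r ε) u (pad m n T) := by
  simp [conormal]

theorem pad_lastVec : pad m n (lastVec n) = 0 := by
  ext i
  by_cases h : (i : ℕ) < n - 1
  · simp [pad_apply, h, coord_lastVec h]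
  · simp [pad_apply, h]

theorem conormal_lastVec (hn : 1 ≤ n) (u : EuclideanSpace ℝ (Fin m)) :
    conormal m n r ε u (lastVec n) = 1 := by
  rw [conormal_apply, pad_lastVec, map_zero, sub_zero, coord_lastVec_last hn]

theorem conormal_fderiv (hn : 1 ≤ n) (hnm : n ≤ m) {u : EuclideanSpace ℝ (Fin m)}
    (hu : IsCritical m n r ε u) (v : EuclideanSpace ℝ (Fin m)) :
    conormal m n r ε u (fderiv ℝ (normalForm m n r ε) u v) = 0 := by
  rw [fderiv_normalForm, map_add, map_smul, conormal_lastVec hn, conormal_apply, coord_trunc_last]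
  have h : v - pad m n (trunc m n v) ∈ fibreSpace m n := fun j hj => by
    rw [← coordCLM_apply, map_sub, coordCLM_apply, coordCLM_apply, coord_pad hnm hj,
      coord_trunc hj, sub_self]
  have h1 := hu _ h
  rw [map_sub] at h1
  simp only [smul_eq_mul]
  linarith

theorem mem_range_fderiv_normalForm (hn : 1 ≤ n) (hnm : n ≤ m) {u : EuclideanSpace ℝ (Fin m)}
    (hu : IsCritical m n r ε u) {T : EuclideanSpace ℝ (Fin n)} :
    T ∈ LinearMap.range (fderiv ℝ (normalForm m n r ε) u).toLinearMap ↔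
      conormal m n r ε u T = 0 := by
  constructor
  · rintro ⟨v, rfl⟩
    exact conormal_fderiv hn hnm hu v
  · intro h
    rw [conormal_apply] at h
    refine ⟨pad m n T, ?_⟩
    change fderiv ℝ (normalForm m n r ε) u (pad m n T) = T
    rw [fderiv_normalForm]
    refine ext_coord_last (fun j hj => ?_) ?_
    · rw [coord_add, coord_smul, coord_lastVec hj, coord_trunc hj, coord_pad hnm hj]
      ring
    · rw [coord_add, coord_smul, coord_lastVec_last hn, coord_trunc_last]
      linarith

/-- At a singular point of the normal form the kernel of the differential is the fibre space. -/
theorem fderiv_normalForm_eq_zero_iff {u : EuclideanSpace ℝ (Fin m)}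
    (hu : IsCritical m n r ε u) {v : EuclideanSpace ℝ (Fin m)} :
    fderiv ℝ (normalForm m n r ε) u v = 0 ↔ v ∈ fibreSpace m n := by
  rw [fderiv_normalForm]
  constructor
  · intro h j hj
    have h1 := congrArg (coord · j) h
    simpa [coord_trunc hj, coord_lastVec hj] using h1
  · intro h
    rw [hu v h, zero_smul, add_zero]
    refine ext_coord_last (fun j hj => ?_) ?_
    · rw [coord_trunc hj, h j hj, coord_zero]
    · rw [coord_trunc_last, coord_zero]

theorem surjective_fderiv_normalForm_iff (hn : 1 ≤ n) (hnm : n ≤ m)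
    {u : EuclideanSpace ℝ (Fin m)} :
    Function.Surjective (fderiv ℝ (normalForm m n r ε) u) ↔ ¬ IsCritical m n r ε u := by
  constructor
  · intro h hu
    obtain ⟨v, hv⟩ := h (lastVec n)
    have h1 := conormal_fderiv hn hnm hu v
    rw [hv, conormal_lastVec hn] at h1
    exact one_ne_zero h1
  · intro h T
    simp only [IsCritical, not_forall] at h
    obtain ⟨v, hv, hv0⟩ := h
    refine ⟨pad m n T + ((coord T (n - 1) - fderiv ℝ (normalFormLast m n r ε) u (pad m n T)) /
      fderiv ℝ (normalFormLast m n r ε) u v) • v, ?_⟩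
    rw [fderiv_normalForm]
    refine ext_coord_last (fun j hj => ?_) ?_
    · simp [coord_trunc hj, coord_lastVec hj, coord_pad hnm hj, hv j hj]
    · rw [coord_add, coord_smul, coord_lastVec_last hn, coord_trunc_last, map_add, map_smul]
      simp only [smul_eq_mul]
      field_simp
      ring

end Differential

/-! ### Invariance of the second intrinsic derivative -/

section Hessian

variable {E₁ E₂ G₁ G₂ : Type*} [NormedAddCommGroup E₁] [NormedSpace ℝ E₁]
  [NormedAddCommGroup E₂] [NormedSpace ℝ E₂] [NormedAddCommGroup G₁] [NormedSpace ℝ G₁]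
  [NormedAddCommGroup G₂] [NormedSpace ℝ G₂]

/-- The chain rule for second derivatives. -/
theorem fderiv_fderiv_comp {F : E₂ → G₂} {g : E₁ → E₂} {a : E₁} (hF : ContDiffAt ℝ 2 F (g a))
    (hg : ContDiffAt ℝ 2 g a) (v w : E₁) :
    fderiv ℝ (fderiv ℝ (F ∘ g)) a v w =
      fderiv ℝ (fderiv ℝ F) (g a) (fderiv ℝ g a v) (fderiv ℝ g a w) +
        fderiv ℝ F (g a) (fderiv ℝ (fderiv ℝ g) a v w) := by
  have hev : fderiv ℝ (F ∘ g) =ᶠ[𝓝 a] fun x => (fderiv ℝ F (g x)).comp (fderiv ℝ g x) := by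
    have h1 := (hF.eventually (by simp)).filter_mono
      (show Filter.map g (𝓝 a) ≤ 𝓝 (g a) from hg.continuousAt)
    rw [Filter.eventually_map] at h1
    filter_upwards [h1, hg.eventually (by simp)] with x hx hx'
    exact fderiv_comp x (hx.differentiableAt (by simp)) (hx'.differentiableAt (by simp))
  have hF' : DifferentiableAt ℝ (fderiv ℝ F) (g a) :=
    (hF.fderiv_right (m := 1) (by norm_num)).differentiableAt (by simp)
  have hg' : DifferentiableAt ℝ (fderiv ℝ g) a :=
    (hg.fderiv_right (m := 1) (by norm_num)).differentiableAt (by simp)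
  have hd : HasFDerivAt (fun x => (fderiv ℝ F (g x)).comp (fderiv ℝ g x)) _ a :=
    (hF'.hasFDerivAt.comp a (hg.differentiableAt (by simp)).hasFDerivAt).clm_comp hg'.hasFDerivAt
  rw [hev.fderiv_eq, hd.fderiv]
  simp [add_comm]

/-- The second intrinsic derivative: if `F₁` and `F₂` are related by changes of coordinates `g` of
the source and `h` of the target, then the Hessians of `F₁` and `F₂` agree on the kernel of the
differential, modulo its image. -/
theorem fderiv_fderiv_of_conj {F₁ : E₁ → G₁} {F₂ : E₂ → G₂} {g : E₁ → E₂} {h : G₁ → G₂} {a : E₁}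
    (hF₁ : ContDiffAt ℝ 2 F₁ a) (hF₂ : ContDiffAt ℝ 2 F₂ (g a)) (hg : ContDiffAt ℝ 2 g a)
    (hh : ContDiffAt ℝ 2 h (F₁ a)) (hcomm : F₂ ∘ g =ᶠ[𝓝 a] h ∘ F₁) {v : E₁}
    (hv : fderiv ℝ F₁ a v = 0) {l : G₂ →L[ℝ] ℝ} (hl : ∀ w, l (fderiv ℝ F₂ (g a) w) = 0) :
    l (fderiv ℝ (fderiv ℝ F₂) (g a) (fderiv ℝ g a v) (fderiv ℝ g a v)) =
      l (fderiv ℝ h (F₁ a) (fderiv ℝ (fderiv ℝ F₁) a v v)) := by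
  have h1 := congrArg l (fderiv_fderiv_comp hF₂ hg v v)
  rw [map_add, hl, add_zero] at h1
  rw [← h1, hcomm.fderiv.fderiv_eq, fderiv_fderiv_comp hh hF₁, hv]
  simp

end Hessian

section Signature

open QuadraticMap Finset

/-- Sylvester's law of inertia for diagonal forms indexed by an interval. -/
theorem card_pos_eq_of_weighted {a b : ℕ} {w w' : ℕ → ℝ}
    (e : (Fin (b - a) → ℝ) ≃ₗ[ℝ] (Fin (b - a) → ℝ))
    (h : ∀ v, ∑ i : Fin (b - a), w' (a + i) * e v i ^ 2 = ∑ i : Fin (b - a), w (a + i) * v i ^ 2) :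
    ((Ico a b).filter fun k => 0 < w' k).card = ((Ico a b).filter fun k => 0 < w k).card := by
  have key : ∀ w : ℕ → ℝ, sigPos (weightedSumSquares ℝ fun i : Fin (b - a) => w (a + i)) =
      ((Ico a b).filter fun k => 0 < w k).card := by
    intro w
    rw [QuadraticForm.sigPos_weightedSumSquares, Set.ncard_eq_toFinset_card']
    refine Finset.card_bij (fun i _ => a + (i : ℕ)) ?_ ?_ ?_
    · intro i hi
      simp only [Set.toFinset_ofPred, mem_filter, mem_univ, true_and] at hi
      simp only [mem_filter, mem_Ico]
      exact ⟨⟨by omega, by omega⟩, hi⟩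
    · intro i _ j _ hij
      exact Fin.ext (by omega)
    · intro k hk
      simp only [mem_filter, mem_Ico] at hk
      refine ⟨⟨k - a, by omega⟩, ?_, by simp; omega⟩
      simp only [Set.toFinset_ofPred, mem_filter, mem_univ, true_and]
      rw [show a + (k - a) = k by omega]
      exact hk.2
  rw [← key, ← key]
  refine (QuadraticMap.Equivalent.sigPos_eq ⟨⟨e, fun v => ?_⟩⟩).symm
  simpa [weightedSumSquares_apply, pow_two] using h v

end Signature

/-- `fibreSpace m n` in coordinates. -/
def fibreSpaceEquiv {m n : ℕ} : fibreSpace m n ≃ₗ[ℝ] (Fin (m - (n - 1)) → ℝ) where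
  toFun v i := coord (v : EuclideanSpace ℝ (Fin m)) (n - 1 + i)
  map_add' v w := by ext i; simp
  map_smul' c v := by ext i; simp
  invFun a := ⟨ofCoords m fun j => if h : n - 1 ≤ j ∧ j < m then a ⟨j - (n - 1), by omega⟩ else 0,
    fun j hj => by
      by_cases h : j < m
      · rw [coord_ofCoords _ h, dif_neg (by omega)]
      · exact dif_neg h⟩
  left_inv v := by
    apply Subtype.ext
    refine ext_coord fun j hj => ?_
    rw [coord_ofCoords _ hj]
    split_ifs with h
    · simp only [show n - 1 + (j - (n - 1)) = j by omega]
    · exact (v.2 j (by omega)).symm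
  right_inv a := by
    ext i
    simp only
    rw [coord_ofCoords _ (by omega), dif_pos ⟨by omega, by omega⟩]
    congr
    simp

/-- Two diagonal forms on the fibre space which correspond to each other under an isomorphism have
the same number of positive coefficients. -/
theorem card_pos_eq_of_fibreSpace {m n : ℕ} {w w' : ℕ → ℝ}
    (e : fibreSpace m n ≃ₗ[ℝ] fibreSpace m n)
    (h : ∀ v : fibreSpace m n,
      ∑ k ∈ Finset.Ico (n - 1) m, w' k * coord (e v : EuclideanSpace ℝ (Fin m)) k ^ 2 =
        ∑ k ∈ Finset.Ico (n - 1) m, w k * coord (v : EuclideanSpace ℝ (Fin m)) k ^ 2) :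
    ((Finset.Ico (n - 1) m).filter fun k => 0 < w' k).card =
      ((Finset.Ico (n - 1) m).filter fun k => 0 < w k).card := by
  refine card_pos_eq_of_weighted ((fibreSpaceEquiv.symm.trans e).trans fibreSpaceEquiv) fun v => ?_
  have h1 := h (fibreSpaceEquiv.symm v)
  rw [Finset.sum_Ico_eq_sum_range, Finset.sum_range, Finset.sum_Ico_eq_sum_range,
    Finset.sum_range] at h1
  have h2 : ∀ i : Fin (m - (n - 1)),
      coord (fibreSpaceEquiv.symm v : EuclideanSpace ℝ (Fin m)) (n - 1 + i) = v i := fun i =>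
    congrFun (fibreSpaceEquiv.apply_symm_apply v) i
  simp only [h2] at h1
  exact h1

/-! ### Comparison of two normal forms at a common singular point -/

theorem surjective_iff_of_conj {α α' β β' : Type*} (A : α ≃ α') (B : β ≃ β') {T : α → β}
    {T' : α' → β'} (h : ∀ v, B (T v) = T' (A v)) :
    Function.Surjective T ↔ Function.Surjective T' := by
  rw [← EquivLike.comp_surjective T B, ← EquivLike.surjective_comp A T']
  exact iff_of_eq (congrArg _ (funext h))

theorem two_le_infty : (2 : ℕ∞ω) ≤ ∞ := by
  exact WithTop.coe_le_coe.2 (le_top : (2 : ℕ∞) ≤ ⊤)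

section Charts

variable {d : ℕ} {X : Type*} [TopologicalSpace X] [ChartedSpace (EuclideanSpace ℝ (Fin d)) X]
  {φ φ' : OpenPartialHomeomorph X (EuclideanSpace ℝ (Fin d))} {x : X}

theorem mdifferentiable_of_mem_maximalAtlas (hφ : φ ∈ IsManifold.maximalAtlas (𝓡 d) ∞ X) :
    φ.MDifferentiable (𝓡 d) (𝓡 d) :=
  ⟨(contMDiffOn_of_mem_maximalAtlas hφ).mdifferentiableOn (by simp),
    (contMDiffOn_symm_of_mem_maximalAtlas hφ).mdifferentiableOn (by simp)⟩

/-- The differential of a chart at a point of its source, as a linear isomorphism. -/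
def chartDeriv (hφ : φ ∈ IsManifold.maximalAtlas (𝓡 d) ∞ X) (hx : x ∈ φ.source) :
    TangentSpace (𝓡 d) x ≃ₗ[ℝ] EuclideanSpace ℝ (Fin d) :=
  ((mdifferentiable_of_mem_maximalAtlas hφ).mfderiv hx).toLinearEquiv

theorem contDiffAt_transition (hφ : φ ∈ IsManifold.maximalAtlas (𝓡 d) ∞ X)
    (hφ' : φ' ∈ IsManifold.maximalAtlas (𝓡 d) ∞ X) (hx : x ∈ φ.source) (hx' : x ∈ φ'.source) :
    ContDiffAt ℝ ∞ (φ' ∘ φ.symm) (φ x) := by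
  rw [← contMDiffAt_iff_contDiffAt]
  refine ContMDiffAt.comp (I' := 𝓡 d) _ ?_ (contMDiffAt_symm_of_mem_maximalAtlas hφ
    (φ.map_source hx))
  rw [φ.left_inv hx]
  exact contMDiffAt_of_mem_maximalAtlas hφ' hx'

theorem fderiv_transition (hφ : φ ∈ IsManifold.maximalAtlas (𝓡 d) ∞ X)
    (hφ' : φ' ∈ IsManifold.maximalAtlas (𝓡 d) ∞ X) (hx : x ∈ φ.source) (hx' : x ∈ φ'.source)
    (v : TangentSpace (𝓡 d) x) :
    fderiv ℝ (φ' ∘ φ.symm) (φ x) (mfderiv (𝓡 d) (𝓡 d) φ x v) =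
      mfderiv (𝓡 d) (𝓡 d) φ' x v := by
  have hev : φ' =ᶠ[𝓝 x] (φ' ∘ φ.symm) ∘ φ := by
    filter_upwards [φ.open_source.mem_nhds hx] with y hy
    simp [φ.left_inv hy]
  have hd : MDifferentiableAt (𝓡 d) (𝓡 d) (φ' ∘ φ.symm) (φ x) :=
    ((contDiffAt_transition hφ hφ' hx hx').differentiableAt (by simp)).mdifferentiableAt
  rw [hev.mfderiv_eq, mfderiv_comp x hd
    ((mdifferentiable_of_mem_maximalAtlas hφ).mdifferentiableAt hx), mfderiv_eq_fderiv]
  rfl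

/-- The differential of a map of manifolds in charts. -/
theorem chartDeriv_mfderiv {d' : ℕ} {Y : Type*} [TopologicalSpace Y]
    [ChartedSpace (EuclideanSpace ℝ (Fin d')) Y]
    {ψ : OpenPartialHomeomorph Y (EuclideanSpace ℝ (Fin d'))} {g : X → Y}
    {G : EuclideanSpace ℝ (Fin d) → EuclideanSpace ℝ (Fin d')}
    (hφ : φ ∈ IsManifold.maximalAtlas (𝓡 d) ∞ X) (hψ : ψ ∈ IsManifold.maximalAtlas (𝓡 d') ∞ Y)
    (hx : x ∈ φ.source) (hgx : g x ∈ ψ.source) (hg : MDifferentiableAt (𝓡 d) (𝓡 d') g x)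
    (hG : DifferentiableAt ℝ G (φ x)) (hev : ψ ∘ g =ᶠ[𝓝 x] G ∘ φ) (v : TangentSpace (𝓡 d) x) :
    chartDeriv hψ hgx (mfderiv (𝓡 d) (𝓡 d') g x v) =
      fderiv ℝ G (φ x) (chartDeriv hφ hx v) := by
  have h1 := hev.mfderiv_eq (I := 𝓡 d) (I' := 𝓡 d')
  rw [mfderiv_comp x ((mdifferentiable_of_mem_maximalAtlas hψ).mdifferentiableAt hgx) hg,
    mfderiv_comp x (I' := 𝓡 d) hG.mdifferentiableAt
      ((mdifferentiable_of_mem_maximalAtlas hφ).mdifferentiableAt hx),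
    mfderiv_eq_fderiv] at h1
  exact congrArg (fun T => T v) h1

end Charts

section Counting

variable (m n r : ℕ) (ε : ℕ → ℤˣ)

/-- The positive index of inertia of the fibre Hessian of the normal form. -/
def posIndex (u : EuclideanSpace ℝ (Fin m)) : ℕ :=
  ((Finset.Ico (n - 1) m).filter fun k => 0 < hessWeight m n r ε u k).card

/-- The negative index of inertia of the fibre Hessian of the normal form. -/
def negIndex (u : EuclideanSpace ℝ (Fin m)) : ℕ :=
  ((Finset.Ico (n - 1) m).filter fun k => 0 < -hessWeight m n r ε u k).card

/-- The number of positive signs among `ε_1, …, ε_{m-n}`. -/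
def signCount : ℕ := ((Finset.Ico (n - 1) (m - 1)).filter fun k => ε k = 1).card

variable {m n r ε}

theorem two_mul_sign_pos_iff (s : ℤˣ) : 0 < 2 * ((s : ℤ) : ℝ) ↔ s = 1 := by
  rcases Int.units_eq_one_or s with rfl | rfl
  · simp
  · simp only [Units.val_neg, Units.val_one, Int.cast_neg, Int.cast_one]
    norm_num

theorem posIndex_add_negIndex_iff (hn : 1 ≤ n) (hnm : n ≤ m) (u : EuclideanSpace ℝ (Fin m)) :
    posIndex m n r ε u + negIndex m n r ε u = m - (n - 1) ↔ lastPartial₂ m n r ε u ≠ 0 := by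
  unfold posIndex negIndex
  rw [← Finset.card_union_of_disjoint, ← Finset.filter_or, ← Nat.card_Ico (n - 1) m,
    Finset.card_filter_eq_iff]
  · constructor
    · intro h
      have h1 := h (m - 1) (Finset.mem_Ico.2 ⟨by omega, by omega⟩)
      rw [hessWeight, if_pos rfl] at h1
      rintro h2
      simp [h2] at h1
    · intro h k _
      unfold hessWeight
      split_ifs
      · rcases lt_or_gt_of_ne h with h1 | h1
        · exact Or.inr (by linarith)
        · exact Or.inl h1
      · rcases Int.units_eq_one_or (ε k) with h1 | h1 <;> simp [h1]
  · rw [Finset.disjoint_filter]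
    intro k _ h1 h2
    linarith

theorem posIndex_eq (hn : 1 ≤ n) (hnm : n ≤ m) (u : EuclideanSpace ℝ (Fin m)) :
    posIndex m n r ε u = signCount m n ε + if 0 < lastPartial₂ m n r ε u then 1 else 0 := by
  unfold posIndex signCount
  have hm : Finset.Ico (n - 1) m = Finset.Ico (n - 1) (m - 1 + 1) := by
    rw [show m - 1 + 1 = m by omega]
  rw [Finset.card_filter, Finset.card_filter, hm, Finset.sum_Ico_succ_top (by omega)]
  congr 1
  · refine Finset.sum_congr rfl fun k hk => ?_
    rw [Finset.mem_Ico] at hk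
    rw [show hessWeight m n r ε u k = _ from if_neg (by omega)]
    simp only [two_mul_sign_pos_iff]
  · rw [show hessWeight m n r ε u (m - 1) = _ from if_pos rfl]

theorem posIndex_one (u : EuclideanSpace ℝ (Fin m)) :
    posIndex m n 1 ε u = ((Finset.Ico (n - 1) m).filter fun k => ε k = 1).card := by
  unfold posIndex
  simp only [hessWeight_one, two_mul_sign_pos_iff]

end Counting

section NormalForm

variable {m n : ℕ}
  {M : Type*} [TopologicalSpace M] [ChartedSpace (EuclideanSpace ℝ (Fin m)) M]
  {N : Type*} [TopologicalSpace N] [ChartedSpace (EuclideanSpace ℝ (Fin n)) N]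
  {f : M → N} {r r' : ℕ} {x x' y : M}
  {φ φ' : OpenPartialHomeomorph M (EuclideanSpace ℝ (Fin m))}
  {ψ ψ' : OpenPartialHomeomorph N (EuclideanSpace ℝ (Fin n))} {ε ε' : ℕ → ℤˣ}

theorem IsNormalFormAt.mfderiv_mfderiv (h : IsNormalFormAt f r x φ ψ ε)
    (hf : ContMDiff (𝓡 m) (𝓡 n) ∞ f) (hy : y ∈ φ.source) (v : TangentSpace (𝓡 m) y) :
    chartDeriv h.target_chart (h.mapsTo hy) (mfderiv (𝓡 m) (𝓡 n) f y v) =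
      fderiv ℝ (normalForm m n r ε) (φ y) (chartDeriv h.source_chart hy v) := by
  refine chartDeriv_mfderiv h.source_chart h.target_chart hy (h.mapsTo hy)
    (hf.mdifferentiable (by simp) y)
    (contDiff_normalForm.differentiable (n := 1) (by simp) _) ?_ v
  filter_upwards [φ.open_source.mem_nhds hy] with z hz
  exact h.eq_normalForm z hz

/-- As `n ≤ m`, the singular points are the points at which the differential is not onto. -/
theorem mem_singularSet_iff_not_surjective (hnm : n ≤ m) {f : M → N} {y : M} :
    y ∈ singularSet m n f ↔ ¬ Function.Surjective (mfderiv (𝓡 m) (𝓡 n) f y) := by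
  have hm : Module.finrank ℝ (TangentSpace (𝓡 m) y) = m := finrank_euclideanSpace_fin
  have hn : Module.finrank ℝ (TangentSpace (𝓡 n) (f y)) = n := finrank_euclideanSpace_fin
  have : FiniteDimensional ℝ (TangentSpace (𝓡 m) y) :=
    inferInstanceAs (FiniteDimensional ℝ (EuclideanSpace ℝ (Fin m)))
  have : FiniteDimensional ℝ (TangentSpace (𝓡 n) (f y)) :=
    inferInstanceAs (FiniteDimensional ℝ (EuclideanSpace ℝ (Fin n)))
  have h1 := LinearMap.finrank_range_add_finrank_ker (mfderiv (𝓡 m) (𝓡 n) f y).toLinearMap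
  rw [hm] at h1
  have h2 := Submodule.finrank_le (LinearMap.range (mfderiv (𝓡 m) (𝓡 n) f y).toLinearMap)
  rw [hn] at h2
  have h3 : Function.Surjective (mfderiv (𝓡 m) (𝓡 n) f y) ↔
      LinearMap.range (mfderiv (𝓡 m) (𝓡 n) f y).toLinearMap = ⊤ := by
    rw [LinearMap.range_eq_top]; rfl
  rw [h3, singularSet, Set.mem_ofPred_eq, ne_eq, not_iff_not]
  constructor
  · intro h
    exact Submodule.eq_top_of_finrank_eq (by omega)
  · intro h
    rw [h, finrank_top, hn] at h1
    omega

theorem IsNormalFormAt.mem_singularSet_iff (h : IsNormalFormAt f r x φ ψ ε)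
    (hf : ContMDiff (𝓡 m) (𝓡 n) ∞ f) (hn : 1 ≤ n) (hnm : n ≤ m) (hy : y ∈ φ.source) :
    y ∈ singularSet m n f ↔ IsCritical m n r ε (φ y) := by
  rw [mem_singularSet_iff_not_surjective hnm, not_iff_comm,
    ← surjective_fderiv_normalForm_iff hn hnm]
  exact (surjective_iff_of_conj (chartDeriv h.source_chart hy).toEquiv
    (chartDeriv h.target_chart (h.mapsTo hy)).toEquiv (h.mfderiv_mfderiv hf hy)).symm

theorem IsNormalFormAt.mem_range_mfderiv_iff (h : IsNormalFormAt f r x φ ψ ε)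
    (hf : ContMDiff (𝓡 m) (𝓡 n) ∞ f) (hn : 1 ≤ n) (hnm : n ≤ m) (hy : y ∈ φ.source)
    (hs : y ∈ singularSet m n f) {ν : TangentSpace (𝓡 n) (f y)} :
    ν ∈ LinearMap.range (mfderiv (𝓡 m) (𝓡 n) f y).toLinearMap ↔
      conormal m n r ε (φ y) (chartDeriv h.target_chart (h.mapsTo hy) ν) = 0 := by
  rw [← mem_range_fderiv_normalForm hn hnm ((h.mem_singularSet_iff hf hn hnm hy).1 hs)]
  constructor
  · rintro ⟨v, rfl⟩
    exact ⟨chartDeriv h.source_chart hy v, (h.mfderiv_mfderiv hf hy v).symm⟩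
  · rintro ⟨w, hw⟩
    obtain ⟨v, rfl⟩ := (chartDeriv h.source_chart hy).surjective w
    refine ⟨v, (chartDeriv h.target_chart (h.mapsTo hy)).injective ?_⟩
    exact (h.mfderiv_mfderiv hf hy v).trans hw

theorem IsNormalFormAt.mfderiv_eq_zero_iff (h : IsNormalFormAt f r x φ ψ ε)
    (hf : ContMDiff (𝓡 m) (𝓡 n) ∞ f) (hn : 1 ≤ n) (hnm : n ≤ m) (hy : y ∈ φ.source)
    (hs : y ∈ singularSet m n f) {v : TangentSpace (𝓡 m) y} :
    mfderiv (𝓡 m) (𝓡 n) f y v = 0 ↔ chartDeriv h.source_chart hy v ∈ fibreSpace m n := by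
  rw [← fderiv_normalForm_eq_zero_iff ((h.mem_singularSet_iff hf hn hnm hy).1 hs),
    ← h.mfderiv_mfderiv hf hy]
  exact (map_eq_zero_iff _ (chartDeriv h.target_chart (h.mapsTo hy)).injective).symm

/-- Comparison of two normal forms at a common singular point: the conormal functionals are
proportional, and the indices of the fibre Hessians agree or are interchanged according to the sign
of the factor. -/
theorem IsNormalFormAt.compare (h : IsNormalFormAt f r x φ ψ ε)
    (h' : IsNormalFormAt f r' x' φ' ψ' ε') (hf : ContMDiff (𝓡 m) (𝓡 n) ∞ f)
    (hnm : n ≤ m) (hr : 1 ≤ r) (hrn : r ≤ n) (hr' : 1 ≤ r') (hrn' : r' ≤ n)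
    (hy : y ∈ φ.source) (hy' : y ∈ φ'.source) (hs : y ∈ singularSet m n f) :
    ∃ l : ℝ, l ≠ 0 ∧
      (∀ ν, conormal m n r' ε' (φ' y) (chartDeriv h'.target_chart (h'.mapsTo hy') ν) =
        l * conormal m n r ε (φ y) (chartDeriv h.target_chart (h.mapsTo hy) ν)) ∧
      (0 < l → posIndex m n r' ε' (φ' y) = posIndex m n r ε (φ y) ∧
        negIndex m n r' ε' (φ' y) = negIndex m n r ε (φ y)) ∧
      (l < 0 → posIndex m n r' ε' (φ' y) = negIndex m n r ε (φ y) ∧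
        negIndex m n r' ε' (φ' y) = posIndex m n r ε (φ y)) := by
  have hn : 1 ≤ n := hr.trans hrn
  have hu := (h.mem_singularSet_iff hf hn hnm hy).1 hs
  have hu' := (h'.mem_singularSet_iff hf hn hnm hy').1 hs
  set A := chartDeriv h.source_chart hy with hA
  set A' := chartDeriv h'.source_chart hy' with hA'
  set B := chartDeriv h.target_chart (h.mapsTo hy) with hB
  set B' := chartDeriv h'.target_chart (h'.mapsTo hy') with hB'
  set l : ℝ := conormal m n r' ε' (φ' y) (B' (B.symm (lastVec n))) with hl
  -- both functionals vanish exactly on the image of the differential, so they are proportional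
  have hlin : ∀ ν, conormal m n r' ε' (φ' y) (B' ν) = l * conormal m n r ε (φ y) (B ν) := by
    intro ν
    have h1 : ν - conormal m n r ε (φ y) (B ν) • B.symm (lastVec n) ∈
        LinearMap.range (mfderiv (𝓡 m) (𝓡 n) f y).toLinearMap := by
      rw [h.mem_range_mfderiv_iff hf hn hnm hy hs]
      change conormal m n r ε (φ y) (B _) = 0
      rw [map_sub, map_smul, B.apply_symm_apply, map_sub, map_smul, conormal_lastVec hn]
      simp
    have h2 := (h'.mem_range_mfderiv_iff hf hn hnm hy' hs).1 h1
    change conormal m n r' ε' (φ' y) (B' _) = 0 at h2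
    rw [map_sub, map_smul, map_sub, map_smul, smul_eq_mul] at h2
    linarith
  have hl0 : l ≠ 0 := by
    intro h0
    have h1 := hlin (B'.symm (lastVec n))
    rw [B'.apply_symm_apply, conormal_lastVec hn, h0, zero_mul] at h1
    exact one_ne_zero h1
  -- the change of charts of the source preserves the kernel of the differential
  have hG : ∀ v, (A.symm.trans A') v ∈ fibreSpace m n ↔ v ∈ fibreSpace m n := by
    intro v
    have h1 := h.mfderiv_eq_zero_iff hf hn hnm hy hs (v := A.symm v)
    have h2 := h'.mfderiv_eq_zero_iff hf hn hnm hy' hs (v := A.symm v)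
    rw [h1] at h2
    change A (A.symm v) ∈ _ ↔ A' (A.symm v) ∈ _ at h2
    rw [A.apply_symm_apply] at h2
    exact h2.symm
  let e : fibreSpace m n ≃ₗ[ℝ] fibreSpace m n :=
    (A.symm.trans A').ofSubmodules _ _ (by
      ext w
      rw [Submodule.mem_map]
      constructor
      · rintro ⟨v, hv, rfl⟩
        exact (hG v).2 hv
      · intro hw
        refine ⟨(A.symm.trans A').symm w, (hG _).1 ?_, ?_⟩
        · rwa [LinearEquiv.apply_symm_apply]
        · exact LinearEquiv.apply_symm_apply _ w)
  have hgd : ∀ v, fderiv ℝ (φ' ∘ φ.symm) (φ y) v = (A.symm.trans A') v := by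
    intro v
    have h1 := fderiv_transition h.source_chart h'.source_chart hy hy' (A.symm v)
    change fderiv ℝ (φ' ∘ φ.symm) (φ y) (A (A.symm v)) = _ at h1
    rw [A.apply_symm_apply] at h1
    exact h1
  have hhd : ∀ T, fderiv ℝ (ψ' ∘ ψ.symm) (ψ (f y)) T = B' (B.symm T) := by
    intro T
    have h1 := fderiv_transition h.target_chart h'.target_chart (h.mapsTo hy) (h'.mapsTo hy')
      (B.symm T)
    change fderiv ℝ (ψ' ∘ ψ.symm) (ψ (f y)) (B (B.symm T)) = _ at h1
    rw [B.apply_symm_apply] at h1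
    exact h1
  have hga : (φ' ∘ φ.symm) (φ y) = φ' y := by simp [φ.left_inv hy]
  -- on the kernel it takes the Hessian for `h'` to `l` times the Hessian for `h`
  have hquad : ∀ v : fibreSpace m n,
      ∑ k ∈ Finset.Ico (n - 1) m, hessWeight m n r' ε' (φ' y) k *
          coord (e v : EuclideanSpace ℝ (Fin m)) k ^ 2 =
        ∑ k ∈ Finset.Ico (n - 1) m, l * hessWeight m n r ε (φ y) k *
          coord (v : EuclideanSpace ℝ (Fin m)) k ^ 2 := by
    intro v
    have hev : normalForm m n r' ε' ∘ (φ' ∘ φ.symm) =ᶠ[𝓝 (φ y)]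
        (ψ' ∘ ψ.symm) ∘ normalForm m n r ε := by
      have h1 : φ.target ∩ φ.symm ⁻¹' φ'.source ∈ 𝓝 (φ y) :=
        (φ.isOpen_inter_preimage_symm φ'.open_source).mem_nhds
          ⟨φ.map_source hy, by simpa [φ.left_inv hy] using hy'⟩
      filter_upwards [h1] with z hz
      have h2 := h.eq_normalForm _ (φ.map_target hz.1)
      rw [φ.right_inv hz.1] at h2
      simp only [Function.comp_apply]
      rw [← h2, ψ.left_inv (h.mapsTo (φ.map_target hz.1)), h'.eq_normalForm _ hz.2]
    have h3 := fderiv_fderiv_of_conj (F₁ := normalForm m n r ε) (F₂ := normalForm m n r' ε')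
      (g := φ' ∘ φ.symm) (h := ψ' ∘ ψ.symm) (a := φ y) (v := v)
      (l := conormal m n r' ε' (φ' y))
      contDiff_normalForm.contDiffAt contDiff_normalForm.contDiffAt
      ((contDiffAt_transition h.source_chart h'.source_chart hy hy').of_le two_le_infty)
      (by
        rw [← h.eq_normalForm y hy]
        exact (contDiffAt_transition h.target_chart h'.target_chart (h.mapsTo hy)
          (h'.mapsTo hy')).of_le two_le_infty)
      hev ((fderiv_normalForm_eq_zero_iff hu).2 v.2)
      (fun w => by rw [hga]; exact conormal_fderiv hn hnm hu' w)
    have he : fderiv ℝ (φ' ∘ φ.symm) (φ y) v = (e v : EuclideanSpace ℝ (Fin m)) := hgd v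
    rw [hga, he, fderiv_fderiv_normalForm, fderiv_fderiv_normalForm, ← h.eq_normalForm y hy,
      map_smul, map_smul, map_smul, hhd, conormal_lastVec hn, ← hl,
      fderiv_fderiv_normalFormLast hr' hrn' hnm (e v).2,
      fderiv_fderiv_normalFormLast hr hrn hnm v.2, smul_eq_mul, smul_eq_mul, mul_one,
      Finset.sum_mul] at h3
    rw [h3]
    exact Finset.sum_congr rfl fun k _ => by ring
  have hpos := card_pos_eq_of_fibreSpace e hquad
  have hneg := card_pos_eq_of_fibreSpace (w' := fun k => -hessWeight m n r' ε' (φ' y) k)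
    (w := fun k => -(l * hessWeight m n r ε (φ y) k)) e (fun v => by
      simp only [neg_mul, Finset.sum_neg_distrib]
      rw [hquad v])
  refine ⟨l, hl0, hlin, fun hl1 => ?_, fun hl1 => ?_⟩
  · unfold posIndex negIndex
    rw [hpos, hneg]
    simp only [← mul_neg, mul_pos_iff_of_pos_left hl1, and_self]
  · unfold posIndex negIndex
    rw [hpos, hneg]
    have h1 : 0 < -l := by linarith
    constructor
    · simp only [← neg_mul_neg l, mul_pos_iff_of_pos_left h1]
    · simp only [← neg_mul, mul_pos_iff_of_pos_left h1]

end NormalForm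

/-! ### Fold points and the canonical coorientation -/

section Coorientation

variable {m n : ℕ}
  {M : Type*} [TopologicalSpace M] [ChartedSpace (EuclideanSpace ℝ (Fin m)) M]
  {N : Type*} [TopologicalSpace N] [ChartedSpace (EuclideanSpace ℝ (Fin n)) N]
  {f : M → N} {r r' : ℕ} {x x' y : M}
  {φ φ' : OpenPartialHomeomorph M (EuclideanSpace ℝ (Fin m))}
  {ψ ψ' : OpenPartialHomeomorph N (EuclideanSpace ℝ (Fin n))} {ε ε' : ℕ → ℤˣ}

theorem IsNormalFormAt.mem_singularSet (h : IsNormalFormAt f r x φ ψ ε)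
    (hf : ContMDiff (𝓡 m) (𝓡 n) ∞ f) (hnm : n ≤ m) (hr : 1 ≤ r) (hrn : r ≤ n) :
    x ∈ singularSet m n f := by
  rw [h.mem_singularSet_iff hf (hr.trans hrn) hnm h.mem_source, h.source_centred]
  exact isCritical_zero hr hrn hnm

theorem IsNormalFormAt.lastPartial₂_ne_zero_iff (h : IsNormalFormAt f r x φ ψ ε)
    (h' : IsNormalFormAt f r' x' φ' ψ' ε') (hf : ContMDiff (𝓡 m) (𝓡 n) ∞ f)
    (hnm : n ≤ m) (hr : 1 ≤ r) (hrn : r ≤ n) (hr' : 1 ≤ r') (hrn' : r' ≤ n)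
    (hy : y ∈ φ.source) (hy' : y ∈ φ'.source) (hs : y ∈ singularSet m n f) :
    lastPartial₂ m n r ε (φ y) ≠ 0 ↔ lastPartial₂ m n r' ε' (φ' y) ≠ 0 := by
  have hn := hr.trans hrn
  rw [← posIndex_add_negIndex_iff hn hnm, ← posIndex_add_negIndex_iff hn hnm]
  obtain ⟨l, hl, -, h1, h2⟩ := h.compare h' hf hnm hr hrn hr' hrn' hy hy' hs
  rcases lt_or_gt_of_ne hl with hl | hl
  · obtain ⟨h3, h4⟩ := h2 hl
    rw [h3, h4, add_comm]
  · obtain ⟨h3, h4⟩ := h1 hl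
    rw [h3, h4]

theorem lastPartial₂_one_ne_zero (u : EuclideanSpace ℝ (Fin m)) : lastPartial₂ m n 1 ε u ≠ 0 := by
  rw [lastPartial₂_one]
  rcases Int.units_eq_one_or (ε (m - 1)) with h1 | h1 <;> simp [h1]

/-- Near a point of type `A_r` of a Morin map, the fold points are the singular points at which the
fibre Hessian is nondegenerate. That such points are fold points is not proved by a construction of
coordinates: they are of some type `A_s` by assumption, and for `s ≥ 2` the fibre Hessian is
degenerate. -/
theorem IsNormalFormAt.mem_singularType_one_iff (h : IsNormalFormAt f r x φ ψ ε)
    (hf : IsMorinMap m n f) (hnm : n ≤ m) (hr : 1 ≤ r) (hrn : r ≤ n)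
    (hy : y ∈ φ.source) (hs : y ∈ singularSet m n f) :
    y ∈ singularType m n 1 f ↔ lastPartial₂ m n r ε (φ y) ≠ 0 := by
  constructor
  · rintro ⟨h1, h1n, φ', ψ', ε', h'⟩
    exact (h.lastPartial₂_ne_zero_iff h' hf.1 hnm hr hrn h1 h1n hy h'.mem_source hs).2
      (lastPartial₂_one_ne_zero _)
  · intro hne
    obtain ⟨r', hr', hrn', φ', ψ', ε', h'⟩ := hf.2 y hs
    rw [h.lastPartial₂_ne_zero_iff h' hf.1 hnm hr hrn hr' hrn' hy h'.mem_source hs,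
      h'.source_centred] at hne
    obtain rfl | h2 := hr'.eq_or_lt
    · exact ⟨hr', hrn', φ', ψ', ε', h'⟩
    · exact absurd (lastPartial₂_zero h2) hne

theorem IsNormalFormAt.mk_eq_zero_iff (h : IsNormalFormAt f r x φ ψ ε)
    (hf : ContMDiff (𝓡 m) (𝓡 n) ∞ f) (hn : 1 ≤ n) (hnm : n ≤ m) (hy : y ∈ φ.source)
    (hs : y ∈ singularSet m n f) {ν : TangentSpace (𝓡 n) (f y)} :
    (Submodule.Quotient.mk ν : NormalSpace m n f y) = 0 ↔
      conormal m n r ε (φ y) (chartDeriv h.target_chart (h.mapsTo hy) ν) = 0 := by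
  rw [← h.mem_range_mfderiv_iff hf hn hnm hy hs]
  exact Submodule.Quotient.mk_eq_zero _

/-- Two transverse vectors point in the same normal direction if and only if the conormal
functional takes values of the same sign on them. -/
theorem IsNormalFormAt.sameRay_iff (h : IsNormalFormAt f r x φ ψ ε)
    (hf : ContMDiff (𝓡 m) (𝓡 n) ∞ f) (hn : 1 ≤ n) (hnm : n ≤ m) (hy : y ∈ φ.source)
    (hs : y ∈ singularSet m n f) {ν ν' : TangentSpace (𝓡 n) (f y)}
    (hν : (Submodule.Quotient.mk ν : NormalSpace m n f y) ≠ 0)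
    (hν' : (Submodule.Quotient.mk ν' : NormalSpace m n f y) ≠ 0) :
    SameRay ℝ (Submodule.Quotient.mk ν : NormalSpace m n f y) (Submodule.Quotient.mk ν') ↔
      (0 < conormal m n r ε (φ y) (chartDeriv h.target_chart (h.mapsTo hy) ν) ↔
        0 < conormal m n r ε (φ y) (chartDeriv h.target_chart (h.mapsTo hy) ν')) := by
  have hlin : ∀ a b : ℝ, a • (Submodule.Quotient.mk ν : NormalSpace m n f y) =
      b • (Submodule.Quotient.mk ν' : NormalSpace m n f y) ↔
      a * conormal m n r ε (φ y) (chartDeriv h.target_chart (h.mapsTo hy) ν) =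
        b * conormal m n r ε (φ y) (chartDeriv h.target_chart (h.mapsTo hy) ν') := by
    intro a b
    rw [← sub_eq_zero, ← Submodule.Quotient.mk_smul, ← Submodule.Quotient.mk_smul,
      ← Submodule.Quotient.mk_sub, h.mk_eq_zero_iff hf hn hnm hy hs, map_sub, map_smul, map_smul,
      map_sub, map_smul, map_smul, sub_eq_zero, smul_eq_mul, smul_eq_mul]
  have h0 := fun h1 => hν ((h.mk_eq_zero_iff hf hn hnm hy hs).2 h1)
  have h0' := fun h1 => hν' ((h.mk_eq_zero_iff hf hn hnm hy hs).2 h1)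
  set a := conormal m n r ε (φ y) (chartDeriv h.target_chart (h.mapsTo hy) ν)
  set b := conormal m n r ε (φ y) (chartDeriv h.target_chart (h.mapsTo hy) ν')
  constructor
  · intro hr
    obtain ⟨s, t, hs, ht, hst⟩ := hr.exists_pos hν hν'
    rw [hlin] at hst
    rw [← mul_pos_iff_of_pos_left hs, hst, mul_pos_iff_of_pos_left ht]
  · intro hab
    have key : (0 < |b| ∧ 0 < |a|) ∧ |b| * a = |a| * b := by
      refine ⟨⟨abs_pos.2 h0', abs_pos.2 h0⟩, ?_⟩
      rcases lt_or_gt_of_ne h0 with h1 | h1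
      · rw [abs_of_neg h1, abs_of_neg (lt_of_le_of_ne (not_lt.1 (by rw [← hab]; linarith)) h0')]
        ring
      · rw [abs_of_pos h1, abs_of_pos (hab.1 h1)]
        ring
    exact Or.inr (Or.inr ⟨|b|, |a|, key.1.1, key.1.2, (hlin _ _).2 key.2⟩)

/-- The sign of the canonical coorientation of a fold point in the coordinates of a normal form
around it: `∂/∂Z` is canonical if and only if the index of the fibre Hessian is odd. -/
theorem IsNormalFormAt.conormal_pos_iff (h : IsNormalFormAt f r x φ ψ ε)
    (hf : ContMDiff (𝓡 m) (𝓡 n) ∞ f) (hnm : n ≤ m) (heven : Even (m - n)) (hr : 1 ≤ r)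
    (hrn : r ≤ n) (hy : y ∈ φ.source) {c : Coorientation m n f y}
    (hc : IsCanonicalCoorientation f y c) {ν : TangentSpace (𝓡 n) (f y)}
    (hν : PointsAlong f y c ν) :
    conormal m n r ε (φ y) (chartDeriv h.target_chart (h.mapsTo hy) ν) ≠ 0 ∧
    (0 < conormal m n r ε (φ y) (chartDeriv h.target_chart (h.mapsTo hy) ν) ↔
      Odd (posIndex m n r ε (φ y))) := by
  obtain ⟨i, hi, hn, φ', ψ', ε', h', hcard, ν', hν', hν1, hν2⟩ := hc
  obtain ⟨hν3, rfl⟩ := hν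
  have hs := h'.mem_singularSet hf hnm le_rfl hn
  obtain ⟨l, hl, hlin, hp, hng⟩ := h.compare h' hf hnm hr hrn le_rfl hn hy h'.mem_source hs
  have h1 := hlin ν'
  have hν'' : chartDeriv h'.target_chart (h'.mapsTo h'.mem_source) ν' = lastVec n := hν'
  rw [hν'', conormal_lastVec hn] at h1
  refine ⟨fun h2 => hν3 ((h.mk_eq_zero_iff hf hn hnm hy hs).2 h2), ?_⟩
  rw [(h.sameRay_iff hf hn hnm hy hs hν3 hν1).1 ((ray_eq_iff _ _).1 hν2.symm)]
  have hidx : posIndex m n 1 ε' (φ' y) = i := by rw [posIndex_one, hcard]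
  have htot := (posIndex_add_negIndex_iff (r := 1) (ε := ε') hn hnm (φ' y)).2
    (lastPartial₂_one_ne_zero _)
  rw [hidx] at htot
  rcases lt_or_gt_of_ne hl with hl1 | hl1
  · obtain ⟨h3, h4⟩ := hng hl1
    constructor
    · intro h5
      nlinarith
    · intro h5
      rw [← h4] at h5
      exfalso
      -- both indices are odd, but their sum `m - n + 1` is odd
      obtain ⟨a, ha⟩ := heven
      obtain ⟨b, hb⟩ := hi
      obtain ⟨d, hd⟩ := h5
      omega
  · obtain ⟨h3, h4⟩ := hp hl1
    rw [← h3, hidx]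
    refine ⟨fun _ => hi, fun _ => ?_⟩
    by_contra h5
    nlinarith

/-- The reflection of `ℝ^n` in the last coordinate. -/
def reflectLast (n : ℕ) : EuclideanSpace ℝ (Fin n) ≃L[ℝ] EuclideanSpace ℝ (Fin n) :=
  LinearEquiv.toContinuousLinearEquiv <|
    LinearEquiv.ofInvolutive
      { toFun := fun u => ofCoords n fun j => if j = n - 1 then -coord u j else coord u j
        map_add' := fun u v => by
          ext i
          by_cases h : (i : ℕ) = n - 1
          · simp only [ofCoords_apply, if_pos h, coord_add, PiLp.add_apply]; ring
          · simp only [ofCoords_apply, if_neg h, coord_add, PiLp.add_apply]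
        map_smul' := fun c u => by
          ext i
          by_cases h : (i : ℕ) = n - 1
          · simp only [ofCoords_apply, if_pos h, coord_smul, PiLp.smul_apply, smul_eq_mul,
              RingHom.id_apply]
            ring
          · simp only [ofCoords_apply, if_neg h, coord_smul, PiLp.smul_apply, smul_eq_mul,
              RingHom.id_apply] }
      fun u => ext_coord fun i hi => by
        change coord (ofCoords n fun j =>
          if j = n - 1 then
            -coord (ofCoords n fun j => if j = n - 1 then -coord u j else coord u j) j
          else coord (ofCoords n fun j => if j = n - 1 then -coord u j else coord u j) j) i = _
        rw [coord_ofCoords _ hi, coord_ofCoords _ hi]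
        split_ifs <;> simp

theorem reflectLast_apply (u : EuclideanSpace ℝ (Fin n)) :
    reflectLast n u = ofCoords n fun j => if j = n - 1 then -coord u j else coord u j := rfl

theorem reflectLast_normalForm (hn : 1 ≤ n) (hnm : n ≤ m) (ε : ℕ → ℤˣ)
    (u : EuclideanSpace ℝ (Fin m)) :
    reflectLast n (normalForm m n 1 ε u) = normalForm m n 1 (-ε) u := by
  refine ext_coord_last (fun j hj => ?_) ?_
  · rw [reflectLast_apply, coord_ofCoords _ (by omega), if_neg hj.ne, coord_of_lt _ (by omega),
      coord_of_lt _ (by omega)]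
    simp [normalForm, hj]
  · rw [reflectLast_apply, coord_ofCoords _ (by omega), if_pos rfl, coord_of_lt _ (by omega),
      coord_of_lt _ (by omega)]
    simp [normalForm, normalFormLast_one hn hnm]

theorem transHomeomorph_mem_maximalAtlas {d : ℕ} {X : Type*} [TopologicalSpace X]
    [ChartedSpace (EuclideanSpace ℝ (Fin d)) X] [IsManifold (𝓡 d) ∞ X]
    {φ : OpenPartialHomeomorph X (EuclideanSpace ℝ (Fin d))}
    (hφ : φ ∈ IsManifold.maximalAtlas (𝓡 d) ∞ X)
    {e : EuclideanSpace ℝ (Fin d) ≃ₜ EuclideanSpace ℝ (Fin d)} (he : ContDiff ℝ ∞ e)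
    (he' : ContDiff ℝ ∞ e.symm) : φ.transHomeomorph e ∈ IsManifold.maximalAtlas (𝓡 d) ∞ X := by
  refine OpenPartialHomeomorph.mem_maximalAtlas_of_contMDiffOn _ ?_ ?_
  · exact he.contMDiff.comp_contMDiffOn (contMDiffOn_of_mem_maximalAtlas hφ)
  · exact (contMDiffOn_symm_of_mem_maximalAtlas hφ).comp he'.contMDiff.contMDiffOn fun u hu => hu

/-- Reversing the last coordinate of the target of a fold changes all signs. -/
theorem IsNormalFormAt.reflect [IsManifold (𝓡 n) ∞ N] (h : IsNormalFormAt f 1 x φ ψ ε)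
    (hn : 1 ≤ n) (hnm : n ≤ m) :
    IsNormalFormAt f 1 x φ (ψ.transHomeomorph (reflectLast n).toHomeomorph) (-ε) where
  source_chart := h.source_chart
  target_chart := transHomeomorph_mem_maximalAtlas h.target_chart (reflectLast n).contDiff
    (reflectLast n).symm.contDiff
  mem_source := h.mem_source
  map_mem_source := h.map_mem_source
  source_centred := h.source_centred
  target_centred := by
    change reflectLast n (ψ (f x)) = 0
    rw [h.target_centred, map_zero]
  mapsTo := h.mapsTo
  eq_normalForm y hy := by
    change reflectLast n (ψ (f y)) = _
    rw [h.eq_normalForm y hy, reflectLast_normalForm hn hnm]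

/-- A fold chart of odd index gives a canonical coorientation. -/
theorem IsNormalFormAt.exists_canonical (h : IsNormalFormAt f 1 x φ ψ ε)
    (hf : ContMDiff (𝓡 m) (𝓡 n) ∞ f) (hn : 1 ≤ n) (hnm : n ≤ m)
    (hodd : Odd ((Finset.Ico (n - 1) m).filter fun k => ε k = 1).card) :
    ∃ c : Coorientation m n f x, IsCanonicalCoorientation f x c := by
  have hs := h.mem_singularSet hf hnm le_rfl hn
  obtain ⟨ν, hν⟩ := (chartDeriv h.target_chart h.map_mem_source).surjective (lastVec n)
  have h0 : (Submodule.Quotient.mk ν : NormalSpace m n f x) ≠ 0 := by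
    rw [Ne, h.mk_eq_zero_iff hf hn hnm h.mem_source hs]
    rw [hν, conormal_lastVec hn]
    exact one_ne_zero
  exact ⟨rayOfNeZero ℝ _ h0, _, hodd, hn, φ, ψ, ε, h, rfl, ν, hν, h0, rfl⟩

/-- Every coorientation is the direction of some vector. -/
theorem exists_pointsAlong (c : Coorientation m n f y) : ∃ ν, PointsAlong f y c ν := by
  induction c using Module.Ray.ind with | h v hv =>
  obtain ⟨ν, rfl⟩ := Submodule.Quotient.mk_surjective _ v
  exact ⟨ν, hv, rfl⟩

/-- A fold point has exactly one canonical coorientation: as `m - n + 1` is odd, exactly one of the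
indices with respect to the two coorientations, which add up to `m - n + 1`, is odd. -/
theorem existsUnique_canonicalCoorientation [IsManifold (𝓡 n) ∞ N]
    (hf : ContMDiff (𝓡 m) (𝓡 n) ∞ f) (hnm : n ≤ m)
    (heven : Even (m - n)) (hx : x ∈ singularType m n 1 f) :
    ∃! c : Coorientation m n f x, IsCanonicalCoorientation f x c := by
  obtain ⟨-, hn, φ, ψ, ε, h⟩ := hx
  have hs := h.mem_singularSet hf hnm le_rfl hn
  have hex : ∃ c : Coorientation m n f x, IsCanonicalCoorientation f x c := by
    by_cases hodd : Odd ((Finset.Ico (n - 1) m).filter fun k => ε k = 1).card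
    · exact h.exists_canonical hf hn hnm hodd
    · refine (h.reflect hn hnm).exists_canonical hf hn hnm ?_
      have h1 := Finset.card_filter_add_card_filter_not (s := Finset.Ico (n - 1) m)
        (fun k => ε k = 1)
      have h2 : ∀ k, ¬ ε k = 1 ↔ (-ε) k = 1 := fun k => by
        rcases Int.units_eq_one_or (ε k) with h1 | h1 <;> simp [h1]
      simp only [h2, Nat.card_Ico] at h1
      rw [Nat.not_odd_iff_even] at hodd
      obtain ⟨a, ha⟩ := heven
      obtain ⟨b, hb⟩ := hodd
      exact ⟨a - b, by omega⟩
  obtain ⟨c, hc⟩ := hex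
  refine ⟨c, hc, fun c' hc' => ?_⟩
  obtain ⟨ν, hν⟩ := exists_pointsAlong c
  obtain ⟨ν', hν'⟩ := exists_pointsAlong c'
  have h1 := (h.conormal_pos_iff hf hnm heven le_rfl hn h.mem_source hc hν).2
  have h2 := (h.conormal_pos_iff hf hnm heven le_rfl hn h.mem_source hc' hν').2
  obtain ⟨h3, rfl⟩ := hν
  obtain ⟨h4, rfl⟩ := hν'
  exact (ray_eq_iff _ _).2
    ((h.sameRay_iff hf hn hnm h.mem_source hs h4 h3).2 (h2.trans h1.symm))

end Coorientation

/-! ### Straightening the singular set of the normal form -/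

section Straightening

/-- The linear map `ℝ^d → ℝ^{d'}` which drops the last coordinates or pads with zeros. -/
def resize (d d' : ℕ) : EuclideanSpace ℝ (Fin d) →L[ℝ] EuclideanSpace ℝ (Fin d') :=
  LinearMap.toContinuousLinearMap
    { toFun := fun u => ofCoords d' fun j => coord u j
      map_add' := fun u v => by ext i; simp
      map_smul' := fun c u => by ext i; simp }

theorem resize_apply {d d' : ℕ} (u : EuclideanSpace ℝ (Fin d)) :
    resize d d' u = ofCoords d' fun j => coord u j := rfl

theorem coord_resize {d d' : ℕ} (u : EuclideanSpace ℝ (Fin d)) {j : ℕ} (hj : j < d') :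
    coord (resize d d' u) j = coord u j := by
  rw [resize_apply, coord_ofCoords _ hj]

theorem coord_of_le {d : ℕ} (u : EuclideanSpace ℝ (Fin d)) {j : ℕ} (hj : d ≤ j) : coord u j = 0 :=
  dif_neg (by omega)

/-- The `k`-th standard basis vector of `ℝ^d`. -/
def single (d k : ℕ) : EuclideanSpace ℝ (Fin d) := ofCoords d fun j => if j = k then 1 else 0

theorem coord_single {d k j : ℕ} (hj : j < d) : coord (single d k) j = if j = k then 1 else 0 :=
  coord_ofCoords _ hj

variable (m n r : ℕ) (ε : ℕ → ℤˣ)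

/-- The change of coordinates of `ℝ^m` replacing `ℓ_2` by `x` and `x` by `∂Z/∂x`; it makes the
singular set of the normal form of type `A_r`, `r ≥ 2`, a coordinate subspace. -/
def straighten (u : EuclideanSpace ℝ (Fin m)) : EuclideanSpace ℝ (Fin m) :=
  ofCoords m fun j =>
    if j = n - r then coord u (m - 1) else if j = m - 1 then lastPartial m n r ε u else coord u j

/-- The point with `x` equal to the coordinate of `w` with position `n - r`, with `ℓ_2 = 0` and with
the other coordinates of `w`. -/
def unstraightenBase (w : EuclideanSpace ℝ (Fin m)) : EuclideanSpace ℝ (Fin m) :=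
  ofCoords m fun j =>
    if j = n - r then 0 else if j = m - 1 then coord w (n - r) else coord w j

/-- The inverse of `straighten`. Since `∂Z/∂x` is the sum of `ℓ_2` and a function of the other
coordinates, `ℓ_2` can be recovered from them and `∂Z/∂x`. -/
def unstraighten (w : EuclideanSpace ℝ (Fin m)) : EuclideanSpace ℝ (Fin m) :=
  unstraightenBase m n r w +
    (coord w (m - 1) - lastPartial m n r ε (unstraightenBase m n r w)) • single m (n - r)

variable {m n r ε}

theorem lastPartial_add_single (hr : 2 ≤ r) (hrn : r ≤ n) (hnm : n ≤ m)
    (u : EuclideanSpace ℝ (Fin m)) (c : ℝ) :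
    lastPartial m n r ε (u + c • single m (n - r)) = lastPartial m n r ε u + c := by
  have hx : coord (u + c • single m (n - r)) (m - 1) = coord u (m - 1) := by
    rw [coord_add, coord_smul, coord_single (by omega), if_neg (by omega)]
    ring
  unfold lastPartial
  rw [hx, ← Finset.add_sum_Ioc_eq_sum_Icc hr, ← Finset.add_sum_Ioc_eq_sum_Icc hr,
    Finset.sum_congr rfl (g := fun i => coord u (n - r + (i - 2)) *
      (((i - 1 : ℕ) : ℝ) * coord u (m - 1) ^ (i - 2)))]
  · rw [coord_add, coord_smul, coord_single (by omega), if_pos (by omega)]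
    norm_num
    ring
  · intro i hi
    rw [Finset.mem_Ioc] at hi
    rw [coord_add, coord_smul, coord_single (by omega), if_neg (by omega)]
    ring

theorem lastPartial₂_add_single (hr : 2 ≤ r) (hrn : r ≤ n) (hnm : n ≤ m)
    (u : EuclideanSpace ℝ (Fin m)) (c : ℝ) :
    lastPartial₂ m n r ε (u + c • single m (n - r)) = lastPartial₂ m n r ε u := by
  have hx : coord (u + c • single m (n - r)) (m - 1) = coord u (m - 1) := by
    rw [coord_add, coord_smul, coord_single (by omega), if_neg (by omega)]
    ring
  unfold lastPartial₂
  rw [hx]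
  congr 1
  refine Finset.sum_congr rfl fun i hi => ?_
  rw [Finset.mem_Icc] at hi
  obtain rfl | h2 := hi.1.eq_or_lt
  · simp
  · rw [coord_add, coord_smul, coord_single (by omega), if_neg (by omega)]
    ring

theorem unstraighten_straighten (hr : 2 ≤ r) (hrn : r ≤ n) (hnm : n ≤ m)
    (u : EuclideanSpace ℝ (Fin m)) :
    unstraighten m n r ε (straighten m n r ε u) = u := by
  have h1 : unstraightenBase m n r (straighten m n r ε u) =
      u + (-coord u (n - r)) • single m (n - r) := by
    refine ext_coord fun j hj => ?_
    rw [unstraightenBase, coord_ofCoords _ hj, coord_add, coord_smul, coord_single hj, straighten,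
      coord_ofCoords _ (by omega), if_pos rfl, coord_ofCoords _ hj]
    split_ifs with h1 h2
    · rw [h1]; ring
    · rw [h2]; ring
    · ring
  have h2 : coord (straighten m n r ε u) (m - 1) = lastPartial m n r ε u := by
    rw [straighten, coord_ofCoords _ (by omega), if_neg (by omega), if_pos rfl]
  rw [unstraighten, h1, h2, lastPartial_add_single hr hrn hnm, add_assoc, ← add_smul]
  simp

theorem coord_unstraighten {w : EuclideanSpace ℝ (Fin m)} {j : ℕ} (hj : j < m) :
    coord (unstraighten m n r ε w) j =
      if j = n - r then coord w (m - 1) - lastPartial m n r ε (unstraightenBase m n r w)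
      else if j = m - 1 then coord w (n - r) else coord w j := by
  rw [unstraighten, coord_add, coord_smul, coord_single hj, unstraightenBase, coord_ofCoords _ hj]
  split_ifs <;> simp

theorem straighten_unstraighten (hr : 2 ≤ r) (hrn : r ≤ n) (hnm : n ≤ m)
    (w : EuclideanSpace ℝ (Fin m)) :
    straighten m n r ε (unstraighten m n r ε w) = w := by
  have hx : coord (unstraighten m n r ε w) (m - 1) = coord w (n - r) := by
    rw [coord_unstraighten (by omega), if_neg (by omega), if_pos rfl]
  refine ext_coord fun j hj => ?_
  rw [straighten, coord_ofCoords _ hj, hx]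
  split_ifs with h1 h2
  · rw [h1]
  · rw [unstraighten, lastPartial_add_single hr hrn hnm, h2]
    ring
  · rw [coord_unstraighten hj, if_neg h1, if_neg h2]

theorem contDiff_straighten : ContDiff ℝ ∞ (straighten m n r ε) := by
  refine contDiff_ofCoords fun j hj => ?_
  split_ifs
  exacts [contDiff_coord _, contDiff_lastPartial, contDiff_coord _]

theorem contDiff_unstraightenBase : ContDiff ℝ ∞ (unstraightenBase m n r) := by
  refine contDiff_ofCoords fun j hj => ?_
  split_ifs
  exacts [contDiff_const, contDiff_coord _, contDiff_coord _]

theorem contDiff_unstraighten : ContDiff ℝ ∞ (unstraighten m n r ε) :=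
  contDiff_unstraightenBase.add (((contDiff_coord _).sub
    (contDiff_lastPartial.comp contDiff_unstraightenBase)).smul contDiff_const)

/-- `straighten` as a homeomorphism. -/
def straightenHomeomorph (hr : 2 ≤ r) (hrn : r ≤ n) (hnm : n ≤ m) (ε : ℕ → ℤˣ) :
    EuclideanSpace ℝ (Fin m) ≃ₜ EuclideanSpace ℝ (Fin m) where
  toFun := straighten m n r ε
  invFun := unstraighten m n r ε
  left_inv := unstraighten_straighten hr hrn hnm
  right_inv := straighten_unstraighten hr hrn hnm
  continuous_toFun := contDiff_straighten.continuous
  continuous_invFun := contDiff_unstraighten.continuous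

theorem isCritical_iff_straighten (hr : 2 ≤ r) (hrn : r ≤ n) (hnm : n ≤ m)
    {u : EuclideanSpace ℝ (Fin m)} :
    IsCritical m n r ε u ↔ ∀ j, n - 1 ≤ j → coord (straighten m n r ε u) j = 0 := by
  rw [isCritical_iff (by omega) hrn hnm]
  have h1 : ∀ j, n - 1 ≤ j → j < m - 1 → coord (straighten m n r ε u) j = coord u j :=
    fun j hj hj' => by
      rw [straighten, coord_ofCoords _ (by omega), if_neg (by omega), if_neg (by omega)]
  have h2 : coord (straighten m n r ε u) (m - 1) = lastPartial m n r ε u := by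
    rw [straighten, coord_ofCoords _ (by omega), if_neg (by omega), if_pos rfl]
  constructor
  · rintro ⟨h3, h4⟩ j hj
    rcases lt_trichotomy j (m - 1) with h5 | rfl | h5
    · rw [h1 j hj h5, h3 j (Finset.mem_Ico.2 ⟨hj, h5⟩)]
    · rw [h2, h4]
    · exact coord_of_le _ (by omega)
  · intro h
    refine ⟨fun k hk => ?_, ?_⟩
    · rw [Finset.mem_Ico] at hk
      rw [← h1 k hk.1 hk.2, h k hk.1]
    · rw [← h2, h _ (by omega)]

/-- Moving along the coordinate with position `n - r` of the singular set moves `x`. -/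
theorem unstraightenBase_line (hr : 2 ≤ r) (hrn : r ≤ n) (hnm : n ≤ m)
    (w : EuclideanSpace ℝ (Fin (n - 1))) (t : ℝ) :
    unstraightenBase m n r (resize (n - 1) m (w + t • single (n - 1) (n - r))) =
      unstraightenBase m n r (resize (n - 1) m w) + t • single m (m - 1) := by
  refine ext_coord fun j hj => ?_
  rw [unstraightenBase, unstraightenBase, coord_ofCoords _ hj, coord_add, coord_smul,
    coord_single hj, coord_ofCoords _ hj, coord_resize _ hj, coord_resize _ (by omega),
    coord_resize _ hj, coord_resize _ (by omega), coord_add, coord_smul, coord_add, coord_smul,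
    coord_single (by omega), if_pos rfl]
  split_ifs with h1 h2 h3
  · omega
  · ring
  · ring
  · by_cases h4 : j < n - 1
    · rw [coord_single h4, if_neg h1]
    · rw [coord_of_le (single _ _) (by omega)]

theorem single_last_mem_fibreSpace (hnm : n ≤ m) : single m (m - 1) ∈ fibreSpace m n :=
  fun j hj => by rw [coord_single (by omega), if_neg (by omega)]

theorem resize_unstraighten (hr : 2 ≤ r) (hrn : r ≤ n) (hnm : n ≤ m)
    (w : EuclideanSpace ℝ (Fin (n - 1))) :
    resize m (n - 1) (unstraighten m n r ε (resize (n - 1) m w)) =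
      w + (-lastPartial m n r ε (unstraightenBase m n r (resize (n - 1) m w)) -
        coord w (n - r)) • single (n - 1) (n - r) := by
  refine ext_coord fun j hj => ?_
  rw [coord_resize _ hj, coord_unstraighten (by omega), coord_add, coord_smul, coord_single hj,
    coord_resize _ (by omega), coord_resize _ (by omega), coord_resize _ (by omega)]
  split_ifs with h1 h2
  · rw [coord_of_le w (by omega : n - 1 ≤ m - 1), h1]
    ring
  · omega
  · ring

/-- In the coordinates of the singular set and the first `n - 1` target coordinates, the Jacobian
of the normal form restricted to its singular set is `-∂²Z/∂x²`. -/
theorem det_fderiv_resize_unstraighten (hr : 2 ≤ r) (hrn : r ≤ n) (hnm : n ≤ m)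
    (w : EuclideanSpace ℝ (Fin (n - 1))) :
    LinearMap.det (fderiv ℝ (fun w : EuclideanSpace ℝ (Fin (n - 1)) =>
        resize m (n - 1) (unstraighten m n r ε (resize (n - 1) m w))) w).toLinearMap =
      -lastPartial₂ m n r ε (unstraighten m n r ε (resize (n - 1) m w)) := by
  set h : EuclideanSpace ℝ (Fin (n - 1)) → ℝ := fun w =>
    -lastPartial m n r ε (unstraightenBase m n r (resize (n - 1) m w)) with hh
  have hd : ContDiff ℝ ∞ h := (contDiff_lastPartial.comp
    (contDiff_unstraightenBase.comp (resize (n - 1) m).contDiff)).neg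
  have hd' : DifferentiableAt ℝ h w := hd.differentiable (by simp) w
  have h1 : HasFDerivAt (fun w : EuclideanSpace ℝ (Fin (n - 1)) =>
        resize m (n - 1) (unstraighten m n r ε (resize (n - 1) m w)))
      (ContinuousLinearMap.id ℝ _ +
        (fderiv ℝ h w - coordCLM (n - 1) (n - r)).smulRight (single (n - 1) (n - r))) w := by
    simp only [resize_unstraighten hr hrn hnm, ← coordCLM_apply]
    exact (hasFDerivAt_id w).add
      ((hd'.hasFDerivAt.sub (coordCLM (n - 1) (n - r)).hasFDerivAt).smul_const _)
  have h2 : fderiv ℝ h w (single (n - 1) (n - r)) =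
      -lastPartial₂ m n r ε (unstraighten m n r ε (resize (n - 1) m w)) := by
    refine (hasDerivAt_comp_line (single (n - 1) (n - r)) hd').unique ?_
    simp only [hh, unstraightenBase_line hr hrn hnm]
    refine (hasDerivAt_lastPartial hrn (single_last_mem_fibreSpace hnm) _).neg.congr_deriv ?_
    rw [coord_single (by omega), if_pos rfl, mul_one, unstraighten,
      lastPartial₂_add_single hr hrn hnm]
  rw [h1.fderiv]
  have h3 : (ContinuousLinearMap.id ℝ _ +
        (fderiv ℝ h w - coordCLM (n - 1) (n - r)).smulRight
          (single (n - 1) (n - r))).toLinearMap =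
      LinearMap.transvection (fderiv ℝ h w - coordCLM (n - 1) (n - r)).toLinearMap
        (single (n - 1) (n - r)) := by
    ext v
    simp [LinearMap.transvection.apply]
  rw [h3, LinearMap.transvection.det]
  simp only [ContinuousLinearMap.coe_coe, sub_apply, coordCLM_apply, h2,
    coord_single (show n - r < n - 1 by omega), if_pos]
  ring

/-- Along every line in the direction of `x` the second derivative `∂²Z/∂x²` is a nonzero
polynomial, so that it vanishes only at finitely many points. -/
theorem dense_lastPartial₂_ne_zero (hr : 2 ≤ r) (hrn : r ≤ n) (hnm : n ≤ m) :
    Dense {w : EuclideanSpace ℝ (Fin (n - 1)) |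
      lastPartial₂ m n r ε (unstraighten m n r ε (resize (n - 1) m w)) ≠ 0} := by
  intro w
  set u := unstraightenBase m n r (resize (n - 1) m w) with hu
  let q : Polynomial ℝ :=
    ∑ i ∈ Finset.Icc 2 r, Polynomial.C (coord u (n - r + (i - 2)) *
      (((i - 1 : ℕ) : ℝ) * ((i - 2 : ℕ) : ℝ))) * Polynomial.X ^ (i - 2 - 1) +
    Polynomial.C (((ε (m - 1) : ℤ) : ℝ) * (((r + 1 : ℕ) : ℝ) * (r : ℝ))) * Polynomial.X ^ (r - 1)
  have hq : q ≠ 0 := by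
    intro h0
    have h1 : q.coeff (r - 1) = ((ε (m - 1) : ℤ) : ℝ) * (((r + 1 : ℕ) : ℝ) * (r : ℝ)) := by
      simp only [q, Polynomial.coeff_add, Polynomial.finsetSum_coeff, Polynomial.coeff_C_mul_X_pow,
        if_true]
      rw [Finset.sum_eq_zero, zero_add]
      intro i hi
      rw [Finset.mem_Icc] at hi
      exact if_neg (by omega)
    rw [h0, Polynomial.coeff_zero] at h1
    have h2 : ((ε (m - 1) : ℤ) : ℝ) ≠ 0 := by simp
    have h3 : (0 : ℝ) < ((r + 1 : ℕ) : ℝ) * (r : ℝ) := by positivity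
    exact mul_ne_zero h2 h3.ne' h1.symm
  have heval : ∀ t : ℝ, lastPartial₂ m n r ε (unstraighten m n r ε (resize (n - 1) m
      (w + (t - coord u (m - 1)) • single (n - 1) (n - r)))) = q.eval t := by
    intro t
    rw [unstraighten, lastPartial₂_add_single hr hrn hnm, unstraightenBase_line hr hrn hnm, ← hu]
    have hx : coord (u + (t - coord u (m - 1)) • single m (m - 1)) (m - 1) = t := by
      rw [coord_add, coord_smul, coord_single (by omega), if_pos rfl]
      ring
    unfold lastPartial₂
    rw [hx]
    simp only [q, Polynomial.eval_add, Polynomial.eval_finsetSum, Polynomial.eval_mul,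
      Polynomial.eval_C, Polynomial.eval_pow, Polynomial.eval_X]
    congr 1
    · refine Finset.sum_congr rfl fun i hi => ?_
      rw [Finset.mem_Icc] at hi
      rw [coord_add, coord_smul, coord_single (by omega), if_neg (by omega)]
      ring
    · ring
  have hdense : Dense {t : ℝ | q.eval t ≠ 0} := by
    have hfin : {t : ℝ | q.eval t = 0}.Finite := by
      refine (q.roots.toFinset.finite_toSet).subset fun t ht => ?_
      simpa [hq] using ht
    exact hfin.countable.dense_compl ℝ
  have hcont : Continuous fun t : ℝ => w + (t - coord u (m - 1)) • single (n - 1) (n - r) := by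
    fun_prop
  have h5 := map_mem_closure hcont (hdense (coord u (m - 1)))
    (t := {w : EuclideanSpace ℝ (Fin (n - 1)) |
      lastPartial₂ m n r ε (unstraighten m n r ε (resize (n - 1) m w)) ≠ 0}) fun t ht => by
        simp only [Set.mem_ofPred_eq, heval]
        exact ht
  simpa using h5

/-- Coordinates of `ℝ^m` in which the singular set of the normal form is the coordinate subspace
`ℝ^{n-1}`, the points of this set with nondegenerate fibre Hessian are dense, and the product of
`∂²Z/∂x²` and the Jacobian of the restricted normal form has a constant sign. -/
theorem exists_straightening (hr : 1 ≤ r) (hrn : r ≤ n) (hnm : n ≤ m) (ε : ℕ → ℤˣ) :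
    ∃ e : EuclideanSpace ℝ (Fin m) ≃ₜ EuclideanSpace ℝ (Fin m),
      ContDiff ℝ ∞ e ∧ ContDiff ℝ ∞ e.symm ∧
      (∀ u, IsCritical m n r ε u ↔ ∀ j, n - 1 ≤ j → coord (e u) j = 0) ∧
      Dense {w : EuclideanSpace ℝ (Fin (n - 1)) |
        lastPartial₂ m n r ε (e.symm (resize (n - 1) m w)) ≠ 0} ∧
      ∃ τ : ℝ, τ ≠ 0 ∧ ∀ w : EuclideanSpace ℝ (Fin (n - 1)),
        lastPartial₂ m n r ε (e.symm (resize (n - 1) m w)) ≠ 0 →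
        0 < τ * (lastPartial₂ m n r ε (e.symm (resize (n - 1) m w)) *
          LinearMap.det (fderiv ℝ (fun w : EuclideanSpace ℝ (Fin (n - 1)) =>
            resize m (n - 1) (e.symm (resize (n - 1) m w))) w).toLinearMap) := by
  obtain rfl | hr2 := hr.eq_or_lt
  -- for a fold the singular set `x_1 = ⋯ = x_{m-n+1} = 0` already is a coordinate subspace
  · refine ⟨Homeomorph.refl _, contDiff_id, contDiff_id, fun u => ?_, ?_,
      ((ε (m - 1) : ℤ) : ℝ), by simp, fun w _ => ?_⟩
    · rw [isCritical_iff le_rfl hrn hnm]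
      have h1 : lastPartial m n 1 ε u = 2 * ((ε (m - 1) : ℤ) : ℝ) * coord u (m - 1) := by
        simp only [lastPartial, show Finset.Icc 2 1 = ∅ by decide, Finset.sum_empty]
        norm_num
        ring
      have h2 : lastPartial m n 1 ε u = 0 ↔ coord u (m - 1) = 0 := by
        rw [h1]
        rcases Int.units_eq_one_or (ε (m - 1)) with h | h <;> simp [h]
      rw [h2]
      constructor
      · rintro ⟨h3, h4⟩ j hj
        rcases lt_trichotomy j (m - 1) with h5 | rfl | h5
        · exact h3 j (Finset.mem_Ico.2 ⟨hj, h5⟩)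
        · exact h4
        · exact coord_of_le _ (by omega)
      · intro h
        exact ⟨fun k hk => h k (Finset.mem_Ico.1 hk).1, h _ (by omega)⟩
    · have h1 : {w : EuclideanSpace ℝ (Fin (n - 1)) |
          lastPartial₂ m n 1 ε ((Homeomorph.refl _).symm (resize (n - 1) m w)) ≠ 0} =
          Set.univ := Set.eq_univ_of_forall fun w => lastPartial₂_one_ne_zero _
      rw [h1]
      exact dense_univ
    · have h1 : (fun w : EuclideanSpace ℝ (Fin (n - 1)) =>
          resize m (n - 1) ((Homeomorph.refl _).symm (resize (n - 1) m w))) = id := by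
        funext w
        refine ext_coord fun j hj => ?_
        change coord (resize m (n - 1) (resize (n - 1) m w)) j = _
        rw [coord_resize _ hj, coord_resize _ (by omega), id]
      rw [h1, fderiv_id, lastPartial₂_one]
      rcases Int.units_eq_one_or (ε (m - 1)) with h | h <;> simp [h]
  · refine ⟨straightenHomeomorph hr2 hrn hnm ε, contDiff_straighten, contDiff_unstraighten,
      fun u => isCritical_iff_straighten hr2 hrn hnm, dense_lastPartial₂_ne_zero hr2 hrn hnm,
      -1, by norm_num, fun w hw => ?_⟩
    change lastPartial₂ m n r ε (unstraighten m n r ε (resize (n - 1) m w)) ≠ 0 at hw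
    have h1 := det_fderiv_resize_unstraighten (ε := ε) hr2 hrn hnm w
    change 0 < -1 * (lastPartial₂ m n r ε (unstraighten m n r ε (resize (n - 1) m w)) *
      LinearMap.det (fderiv ℝ (fun w : EuclideanSpace ℝ (Fin (n - 1)) =>
        resize m (n - 1) (unstraighten m n r ε (resize (n - 1) m w))) w).toLinearMap)
    rw [h1]
    have h2 := mul_self_pos.2 hw
    linarith

end Straightening

/-! ### Submanifolds given by slice charts -/

section Submanifold

variable {m d : ℕ} {M : Type*} [TopologicalSpace M] [ChartedSpace (EuclideanSpace ℝ (Fin m)) M]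
  {S : Set M} {e e' : OpenPartialHomeomorph M (EuclideanSpace ℝ (Fin m))}

variable (d S e) in
/-- A chart of `M` in which the subset `S` is the coordinate subspace `ℝ^d`. -/
structure IsSliceChart : Prop where
  mem_maximalAtlas : e ∈ IsManifold.maximalAtlas (𝓡 m) ∞ M
  mem_iff : ∀ y ∈ e.source, y ∈ S ↔ ∀ j, d ≤ j → coord (e y) j = 0

theorem resize_resize_of_forall_coord_eq_zero {u : EuclideanSpace ℝ (Fin m)}
    (hu : ∀ j, d ≤ j → coord u j = 0) : resize d m (resize m d u) = u := by
  refine ext_coord fun j hj => ?_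
  rw [coord_resize _ hj]
  by_cases h : j < d
  · rw [coord_resize _ h]
  · rw [coord_of_le _ (by omega), hu j (by omega)]

theorem resize_resize (hd : d ≤ m) (w : EuclideanSpace ℝ (Fin d)) :
    resize m d (resize d m w) = w := by
  refine ext_coord fun j hj => ?_
  rw [coord_resize _ hj, coord_resize _ (by omega)]

theorem IsSliceChart.symm_mem (he : IsSliceChart d S e) {w : EuclideanSpace ℝ (Fin d)}
    (hw : resize d m w ∈ e.target) : e.symm (resize d m w) ∈ S := by
  rw [he.mem_iff _ (e.map_target hw), e.right_inv hw]
  intro j hj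
  by_cases h : j < m
  · rw [coord_resize _ h, coord_of_le _ hj]
  · exact coord_of_le _ (by omega)

open Classical in
/-- The chart of `S` induced by a slice chart: the first `d` coordinates. The point `x` of `S` is
the junk value of the inverse. -/
def sliceChart (hd : d ≤ m) (he : IsSliceChart d S e) (x : S) :
    OpenPartialHomeomorph S (EuclideanSpace ℝ (Fin d)) where
  toFun y := resize m d (e y)
  invFun w := if h : e.symm (resize d m w) ∈ S then ⟨_, h⟩ else x
  source := Subtype.val ⁻¹' e.source
  target := resize d m ⁻¹' e.target
  map_source' y hy := by
    rw [Set.mem_preimage, resize_resize_of_forall_coord_eq_zero ((he.mem_iff _ hy).1 y.2)]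
    exact e.map_source hy
  map_target' w hw := by
    rw [dif_pos (he.symm_mem hw)]
    exact e.map_target hw
  left_inv' y hy := by
    simp only [resize_resize_of_forall_coord_eq_zero ((he.mem_iff _ hy).1 y.2), e.left_inv hy,
      Subtype.coe_prop, dite_true]
  right_inv' w hw := by
    rw [dif_pos (he.symm_mem hw)]
    simp only [e.right_inv hw, resize_resize hd]
  open_source := e.open_source.preimage continuous_subtype_val
  open_target := e.open_target.preimage (resize d m).continuous
  continuousOn_toFun := (resize m d).continuous.comp_continuousOn
    (e.continuousOn.comp continuous_subtype_val.continuousOn fun _ h => h)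
  continuousOn_invFun := by
    rw [Topology.IsInducing.subtypeVal.continuousOn_iff]
    refine (e.continuousOn_symm.comp (resize d m).continuous.continuousOn fun _ h => h).congr
      fun w hw => ?_
    simp only [Function.comp_apply, dif_pos (he.symm_mem hw)]

theorem sliceChart_symm_apply (hd : d ≤ m) (he : IsSliceChart d S e) (x : S)
    {w : EuclideanSpace ℝ (Fin d)} (hw : w ∈ (sliceChart hd he x).target) :
    ((sliceChart hd he x).symm w : M) = e.symm (resize d m w) :=
  congrArg Subtype.val (dif_pos (he.symm_mem hw))

/-- The isomorphism `ℝ^d × ℝ^{m-d} ≃ ℝ^m` concatenating coordinates. -/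
def concat (hd : d ≤ m) :
    (EuclideanSpace ℝ (Fin d) × EuclideanSpace ℝ (Fin (m - d))) ≃L[ℝ] EuclideanSpace ℝ (Fin m) :=
  LinearEquiv.toContinuousLinearEquiv
    { toFun := fun p => ofCoords m fun j => if j < d then coord p.1 j else coord p.2 (j - d)
      map_add' := fun p q => by
        ext i
        by_cases h : (i : ℕ) < d <;> simp [h]
      map_smul' := fun c p => by
        ext i
        by_cases h : (i : ℕ) < d <;> simp [h]
      invFun := fun u => (resize m d u, ofCoords (m - d) fun i => coord u (d + i))
      left_inv := fun p => by
        refine Prod.ext (ext_coord fun j hj => ?_) (ext_coord fun j hj => ?_)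
        · rw [coord_resize _ hj, coord_ofCoords _ (by omega), if_pos hj]
        · rw [coord_ofCoords _ hj, coord_ofCoords _ (by omega), if_neg (by omega),
            Nat.add_sub_cancel_left]
      right_inv := fun u => by
        refine ext_coord fun j hj => ?_
        rw [coord_ofCoords _ hj]
        split_ifs with h
        · rw [coord_resize _ h]
        · rw [coord_ofCoords _ (by omega), Nat.add_sub_cancel' (by omega)] }

theorem concat_zero (hd : d ≤ m) (w : EuclideanSpace ℝ (Fin d)) :
    concat hd (w, 0) = resize d m w := by
  change (ofCoords m fun j => if j < d then coord w j else coord 0 (j - d)) = _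
  refine ext_coord fun j hj => ?_
  rw [coord_ofCoords _ hj, coord_resize _ hj]
  split_ifs with h
  · rfl
  · rw [coord_zero, coord_of_le _ (by omega)]

/-- A subset which is a coordinate subspace in suitable charts of `M` is an embedded
submanifold. -/
theorem exists_isSmoothEmbedding_of_isSliceChart (hd : d ≤ m)
    (hS : ∀ x ∈ S, ∃ e : OpenPartialHomeomorph M (EuclideanSpace ℝ (Fin m)),
      IsSliceChart d S e ∧ x ∈ e.source) :
    ∃ _ : ChartedSpace (EuclideanSpace ℝ (Fin d)) S, IsManifold (𝓡 d) ∞ S ∧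
      Manifold.IsSmoothEmbedding (𝓡 d) (𝓡 m) ∞ (Subtype.val : S → M) ∧
      ∀ e : OpenPartialHomeomorph M (EuclideanSpace ℝ (Fin m)), IsSliceChart d S e →
        ∀ x : S, (x : M) ∈ e.source → ∃ σ ∈ IsManifold.maximalAtlas (𝓡 d) ∞ S,
          σ.source = Subtype.val ⁻¹' e.source ∧ ∀ y, σ y = resize m d (e y) := by
  choose c hc hcx using hS
  let cs : ChartedSpace (EuclideanSpace ℝ (Fin d)) S :=
    { atlas := {σ | ∃ e, ∃ he : IsSliceChart d S e, ∃ x, σ = sliceChart hd he x}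
      chartAt := fun x => sliceChart hd (hc x x.2) x
      mem_chart_source := fun x => hcx x x.2
      chart_mem_atlas := fun x => ⟨c x x.2, hc x x.2, x, rfl⟩ }
  have hmem : ∀ {e} (he : IsSliceChart d S e) (x : S),
      sliceChart hd he x ∈ atlas (EuclideanSpace ℝ (Fin d)) S := fun {e} he x => ⟨e, he, x, rfl⟩
  have hman : IsManifold (𝓡 d) ∞ S := by
    refine isManifold_of_contDiffOn _ _ _ ?_
    rintro _ _ ⟨e, he, x, rfl⟩ ⟨e', he', x', rfl⟩
    intro w hw
    obtain ⟨⟨hw1, hw2⟩, -⟩ := hw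
    change w ∈ (sliceChart hd he x).target at hw1
    change ((sliceChart hd he x).symm w : M) ∈ e'.source at hw2
    rw [sliceChart_symm_apply hd he x hw1] at hw2
    have h1 := contDiffAt_transition he.mem_maximalAtlas he'.mem_maximalAtlas
      (e.map_target hw1) hw2
    rw [e.right_inv hw1] at h1
    have h2 : ContDiffAt ℝ ∞ (fun w => resize m d ((e' ∘ e.symm) (resize d m w))) w :=
      (resize m d).contDiff.contDiffAt.comp w (h1.comp w (resize d m).contDiff.contDiffAt)
    refine (h2.congr_of_eventuallyEq ?_).contDiffWithinAt
    filter_upwards [(sliceChart hd he x).open_target.mem_nhds hw1] with z hz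
    change resize m d (e' ((sliceChart hd he x).symm z : M)) = _
    rw [sliceChart_symm_apply hd he x hz]
    rfl
  refine ⟨cs, hman, ⟨?_, Topology.IsEmbedding.subtypeVal⟩, fun e he x hx =>
    ⟨sliceChart hd he x, IsManifold.subset_maximalAtlas (hmem he x), rfl, fun _ => rfl⟩⟩
  refine ⟨EuclideanSpace ℝ (Fin (m - d)), inferInstance, inferInstance, fun x => ?_⟩
  refine Manifold.IsImmersionAtOfComplement.mk_of_charts (concat hd)
    (sliceChart hd (hc x x.2) x) (c x x.2) (hcx x x.2) (hcx x x.2)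
    (IsManifold.subset_maximalAtlas (hmem _ _)) (hc x x.2).mem_maximalAtlas
    (fun _ h => h) fun w hw => ?_
  have hw' : w ∈ (sliceChart hd (hc x x.2) x).target := by simpa using hw
  change c x x.2 ((sliceChart hd (hc x x.2) x).symm w : M) = concat hd (w, 0)
  rw [sliceChart_symm_apply hd _ _ hw', concat_zero, (c x x.2).right_inv hw']

end Submanifold

/-! ### Orientations prescribed on a dense set -/

section Orientation

/-- The standard basis of `ℝ^d`. -/
abbrev stdBasis (d : ℕ) : Module.Basis (Fin d) ℝ (EuclideanSpace ℝ (Fin d)) :=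
  (EuclideanSpace.basisFun (Fin d) ℝ).toBasis

variable {d : ℕ}

theorem exists_sign_of_orientation (o : Orientation ℝ (EuclideanSpace ℝ (Fin d)) (Fin d)) :
    ∃ τ : ℝ, τ ≠ 0 ∧ ∀ w : Module.Basis (Fin d) ℝ (EuclideanSpace ℝ (Fin d)),
      w.orientation = o ↔ 0 < τ * (stdBasis d).det w := by
  rcases (stdBasis d).orientation_eq_or_eq_neg o with rfl | rfl
  · refine ⟨1, one_ne_zero, fun w => ?_⟩
    rw [eq_comm, Module.Basis.orientation_eq_iff_det_pos, one_mul]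
  · refine ⟨-1, by norm_num, fun w => ?_⟩
    rw [← Module.Basis.orientation_ne_iff_eq_neg, Ne, eq_comm,
      Module.Basis.orientation_eq_iff_det_pos, not_lt, neg_one_mul, neg_pos]
    exact ⟨fun h => lt_of_le_of_ne h ((stdBasis d).isUnit_det w).ne_zero, le_of_lt⟩

theorem exists_orientation_of_sign {τ : ℝ} (hτ : τ ≠ 0) :
    ∃ o : Orientation ℝ (EuclideanSpace ℝ (Fin d)) (Fin d),
      ∀ w : Module.Basis (Fin d) ℝ (EuclideanSpace ℝ (Fin d)),
        w.orientation = o ↔ 0 < τ * (stdBasis d).det w := by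
  rcases lt_or_gt_of_ne hτ with h | h
  · refine ⟨-(stdBasis d).orientation, fun w => ?_⟩
    rw [← Module.Basis.orientation_ne_iff_eq_neg, Ne, eq_comm,
      Module.Basis.orientation_eq_iff_det_pos, not_lt, ← neg_mul_neg,
      mul_pos_iff_of_pos_left (neg_pos.2 h), neg_pos]
    exact ⟨fun h => lt_of_le_of_ne h ((stdBasis d).isUnit_det w).ne_zero, le_of_lt⟩
  · refine ⟨(stdBasis d).orientation, fun w => ?_⟩
    rw [eq_comm, Module.Basis.orientation_eq_iff_det_pos, mul_pos_iff_of_pos_left h]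

theorem orientation_map_congr {T T' : EuclideanSpace ℝ (Fin d) ≃ₗ[ℝ] EuclideanSpace ℝ (Fin d)}
    (h : 0 < LinearMap.det (T : EuclideanSpace ℝ (Fin d) →ₗ[ℝ] EuclideanSpace ℝ (Fin d)) *
      LinearMap.det (T' : EuclideanSpace ℝ (Fin d) →ₗ[ℝ] EuclideanSpace ℝ (Fin d)))
    (o : Orientation ℝ (EuclideanSpace ℝ (Fin d)) (Fin d)) :
    Orientation.map (Fin d) T o = Orientation.map (Fin d) T' o := by
  have hd : Fintype.card (Fin d) = Module.finrank ℝ (EuclideanSpace ℝ (Fin d)) := by simp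
  rcases pos_and_pos_or_neg_and_neg_of_mul_pos h with ⟨h1, h2⟩ | ⟨h1, h2⟩
  · rw [(o.map_eq_iff_det_pos T hd).2 h1, (o.map_eq_iff_det_pos T' hd).2 h2]
  · rw [(o.map_eq_neg_iff_det_neg T hd).2 h1, (o.map_eq_neg_iff_det_neg T' hd).2 h2]

variable {X : Type*} [TopologicalSpace X] [ChartedSpace (EuclideanSpace ℝ (Fin d)) X]
  {φ φ' : OpenPartialHomeomorph X (EuclideanSpace ℝ (Fin d))} {x : X}

theorem basis_orientation_eq_iff (hφ : φ ∈ IsManifold.maximalAtlas (𝓡 d) ∞ X)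
    (hx : x ∈ φ.source) {a : Orientation ℝ (TangentSpace (𝓡 d) x) (Fin d)}
    {o₀ : Orientation ℝ (EuclideanSpace ℝ (Fin d)) (Fin d)}
    (ha : Orientation.map (Fin d) (chartDeriv hφ hx) a = o₀)
    (w : Module.Basis (Fin d) ℝ (TangentSpace (𝓡 d) x)) :
    w.orientation = a ↔ (w.map (chartDeriv hφ hx)).orientation = o₀ := by
  rw [Module.Basis.orientation_map, ← ha, (Orientation.map (Fin d) _).apply_eq_iff_eq]

theorem isOrientation_iff {o : ∀ x : X, Orientation ℝ (TangentSpace (𝓡 d) x) (Fin d)} :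
    IsOrientation o ↔ ∀ x₀ : X, ∃ φ, ∃ hφ : φ ∈ IsManifold.maximalAtlas (𝓡 d) ∞ X,
      x₀ ∈ φ.source ∧ ∃ o₀, ∀ᶠ x in 𝓝 x₀, ∀ hx : x ∈ φ.source,
        Orientation.map (Fin d) (chartDeriv hφ hx) (o x) = o₀ := by
  refine forall_congr' fun x₀ => ?_
  constructor
  · rintro ⟨φ, hφ, hx₀, o₀, h⟩
    refine ⟨φ, hφ, hx₀, o₀, Filter.Eventually.of_forall fun x hx => ?_⟩
    obtain ⟨L, hL, hLo⟩ := h x hx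
    rw [← hLo, show L = chartDeriv hφ hx from LinearEquiv.ext hL]
  · rintro ⟨φ, hφ, hx₀, o₀, h⟩
    obtain ⟨V, hV, hVo, hxV⟩ := eventually_nhds_iff.1 h
    refine ⟨φ.restr V, restr_mem_maximalAtlas _ hφ hVo, ?_, o₀, fun x hx => ?_⟩
    · rw [φ.restr_source' V hVo]
      exact ⟨hx₀, hxV⟩
    · rw [φ.restr_source' V hVo] at hx
      exact ⟨chartDeriv hφ hx.1, fun _ => rfl, hV x hx.2 hx.1⟩

/-- The sign of the Jacobian of a change of charts is locally constant. -/
theorem exists_orientation_transition (hφ : φ ∈ IsManifold.maximalAtlas (𝓡 d) ∞ X)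
    (hφ' : φ' ∈ IsManifold.maximalAtlas (𝓡 d) ∞ X) (hx : x ∈ φ.source) (hx' : x ∈ φ'.source)
    (o₀ : Orientation ℝ (EuclideanSpace ℝ (Fin d)) (Fin d)) :
    ∃ o₀' : Orientation ℝ (EuclideanSpace ℝ (Fin d)) (Fin d),
      ∀ᶠ y in 𝓝 x, ∀ (hy : y ∈ φ.source) (hy' : y ∈ φ'.source)
        (a : Orientation ℝ (TangentSpace (𝓡 d) y) (Fin d)),
        Orientation.map (Fin d) (chartDeriv hφ hy) a = o₀ →
          Orientation.map (Fin d) (chartDeriv hφ' hy') a = o₀' := by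
  set T : ∀ y, y ∈ φ.source → y ∈ φ'.source →
      EuclideanSpace ℝ (Fin d) ≃ₗ[ℝ] EuclideanSpace ℝ (Fin d) := fun y hy hy' =>
    (chartDeriv hφ hy).symm.trans (chartDeriv hφ' hy') with hT
  have hdet : ∀ y (hy : y ∈ φ.source) (hy' : y ∈ φ'.source),
      LinearMap.det (T y hy hy' : EuclideanSpace ℝ (Fin d) →ₗ[ℝ] EuclideanSpace ℝ (Fin d)) =
        (fderiv ℝ (φ' ∘ φ.symm) (φ y)).det := by
    intro y hy hy'
    rw [ContinuousLinearMap.det]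
    congr 1
    ext1 v
    have h1 := fderiv_transition hφ hφ' hy hy' ((chartDeriv hφ hy).symm v)
    change fderiv ℝ (φ' ∘ φ.symm) (φ y) (chartDeriv hφ hy ((chartDeriv hφ hy).symm v)) = _ at h1
    rw [LinearEquiv.apply_symm_apply] at h1
    exact h1.symm
  have hcont : ContinuousAt (fun y => (fderiv ℝ (φ' ∘ φ.symm) (φ y)).det *
      (fderiv ℝ (φ' ∘ φ.symm) (φ x)).det) x := by
    have h1 : ContinuousAt (fderiv ℝ (φ' ∘ φ.symm)) (φ x) :=
      ((contDiffAt_transition hφ hφ' hx hx').fderiv_right (m := 0) (by simp)).continuousAt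
    have h2 : ContinuousAt (fun y => fderiv ℝ (φ' ∘ φ.symm) (φ y)) x :=
      ContinuousAt.comp (f := φ) h1 (φ.continuousAt hx)
    exact (ContinuousLinearMap.continuous_det.continuousAt.comp h2).mul continuousAt_const
  have hne : (fderiv ℝ (φ' ∘ φ.symm) (φ x)).det ≠ 0 := by
    rw [← hdet x hx hx']
    exact (LinearEquiv.isUnit_det' _).ne_zero
  refine ⟨Orientation.map (Fin d) (T x hx hx') o₀, ?_⟩
  filter_upwards [hcont.eventually (lt_mem_nhds (mul_self_pos.2 hne))] with y hpos hy hy' a ha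
  rw [← hdet y hy hy', ← hdet x hx hx'] at hpos
  rw [← orientation_map_congr hpos, ← ha]
  have h1 : chartDeriv hφ' hy' = (chartDeriv hφ hy).trans (T y hy hy') :=
    LinearEquiv.ext fun v => (congrArg (chartDeriv hφ' hy')
      ((chartDeriv hφ hy).symm_apply_apply v)).symm
  rw [h1]
  induction a using Module.Ray.ind with | h g hg =>
  rfl

theorem IsOrientation.eventually_map_eq {o : ∀ x : X, Orientation ℝ (TangentSpace (𝓡 d) x) (Fin d)}
    (ho : IsOrientation o) (hφ : φ ∈ IsManifold.maximalAtlas (𝓡 d) ∞ X) (hx : x ∈ φ.source) :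
    ∃ o₀, ∀ᶠ y in 𝓝 x, ∀ hy : y ∈ φ.source,
      Orientation.map (Fin d) (chartDeriv hφ hy) (o y) = o₀ := by
  obtain ⟨φ', hφ', hx', o₁, h⟩ := isOrientation_iff.1 ho x
  obtain ⟨o₀, h1⟩ := exists_orientation_transition hφ' hφ hx' hx o₁
  refine ⟨o₀, ?_⟩
  filter_upwards [h1, h, φ'.open_source.mem_nhds hx'] with y hy hy2 hy' hyφ
  exact hy hy' hyφ _ (hy2 hy')

/-- A condition on the orientations of the tangent spaces at the points of a dense set which
determines them, and which near every point is satisfied by a constant orientation in some chart,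
determines an orientation of the manifold. -/
theorem existsUnique_isOrientation {D : Set X} (hD : Dense D)
    {C : ∀ x : X, Orientation ℝ (TangentSpace (𝓡 d) x) (Fin d) → Prop}
    (huniq : ∀ x ∈ D, ∀ a a', C x a → C x a' → a = a')
    (hloc : ∀ x₀ : X, ∃ φ, ∃ hφ : φ ∈ IsManifold.maximalAtlas (𝓡 d) ∞ X,
      x₀ ∈ φ.source ∧ ∃ o₀, ∀ᶠ x in 𝓝 x₀, ∀ hx : x ∈ φ.source, x ∈ D → ∀ a,
        Orientation.map (Fin d) (chartDeriv hφ hx) a = o₀ → C x a) :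
    ∃! o : ∀ x : X, Orientation ℝ (TangentSpace (𝓡 d) x) (Fin d),
      IsOrientation o ∧ ∀ x ∈ D, C x (o x) := by
  choose φ hφ hx o₀ hC using hloc
  let o : ∀ x : X, Orientation ℝ (TangentSpace (𝓡 d) x) (Fin d) := fun x =>
    (Orientation.map (Fin d) (chartDeriv (hφ x) (hx x))).symm (o₀ x)
  have ho : ∀ x, Orientation.map (Fin d) (chartDeriv (hφ x) (hx x)) (o x) = o₀ x := fun x =>
    Equiv.apply_symm_apply _ _
  -- the value chosen at `y` is the one prescribed by the chart `φ x₀`: both are constant in charts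
  -- near `y`, and they agree at a point of `D` near `y`
  have key : ∀ x₀, ∀ᶠ y in 𝓝 x₀, ∀ hy : y ∈ (φ x₀).source,
      Orientation.map (Fin d) (chartDeriv (hφ x₀) hy) (o y) = o₀ x₀ := by
    intro x₀
    filter_upwards [(hC x₀).eventually_nhds] with y hCy hy
    obtain ⟨o₁, h1⟩ := exists_orientation_transition (hφ y) (hφ x₀) (hx y) hy (o₀ y)
    rw [h1.self_of_nhds (hx y) hy _ (ho y)]
    have h2 := (((h1.and ((φ y).open_source.mem_nhds (hx y))).and
      ((φ x₀).open_source.mem_nhds hy)).and hCy).and (hC y)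
    obtain ⟨z, ⟨⟨⟨⟨hz1, hz2⟩, hz3⟩, hz4⟩, hz5⟩, hzD⟩ := mem_closure_iff_nhds.1 (hD y) _ h2
    have ha := Equiv.apply_symm_apply (Orientation.map (Fin d) (chartDeriv (hφ y) hz2)) (o₀ y)
    have ha' := Equiv.apply_symm_apply (Orientation.map (Fin d) (chartDeriv (hφ x₀) hz3)) (o₀ x₀)
    rw [← hz1 hz2 hz3 _ ha, huniq z hzD _ _ (hz5 hz2 hzD _ ha) (hz4 hz3 hzD _ ha'), ha']
  have hoC : ∀ x ∈ D, C x (o x) := fun x hxD => (hC x).self_of_nhds (hx x) hxD _ (ho x)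
  refine ⟨o, ⟨isOrientation_iff.2 fun x₀ => ⟨φ x₀, hφ x₀, hx x₀, o₀ x₀, key x₀⟩, hoC⟩, ?_⟩
  rintro o' ⟨ho', hoC'⟩
  funext x
  obtain ⟨o₁, h1⟩ := ho'.eventually_map_eq (hφ x) (hx x)
  obtain ⟨z, ⟨⟨hz1, hz2⟩, hz3⟩, hzD⟩ := mem_closure_iff_nhds.1 (hD x) _
    ((h1.and ((φ x).open_source.mem_nhds (hx x))).and (key x))
  have h2 := hz1 hz2
  rw [huniq z hzD _ _ (hoC' z hzD) (hoC z hzD), hz3 hz2] at h2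
  exact (Orientation.map (Fin d) (chartDeriv (hφ x) (hx x))).injective
    ((h1.self_of_nhds (hx x)).trans (h2.symm.trans (ho x).symm))

end Orientation

/-! ### The determinant of a frame of the singular set and a transverse vector -/

section Determinant

theorem stdBasis_det_succ {k : ℕ} (w : Fin (k + 1) → EuclideanSpace ℝ (Fin (k + 1)))
    (v : Fin k → EuclideanSpace ℝ (Fin k)) (h : ∀ i j : Fin k, w j.castSucc i.castSucc = v j i)
    (h0 : ∀ j : Fin k, w j.castSucc (Fin.last k) = 0) :
    (stdBasis (k + 1)).det w = (stdBasis k).det v * w (Fin.last k) (Fin.last k) := by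
  rw [Module.Basis.det_apply, Module.Basis.det_apply, Matrix.det_succ_row _ (Fin.last k),
    Fin.sum_univ_castSucc, Finset.sum_eq_zero, zero_add]
  · have h1 : ((stdBasis (k + 1)).toMatrix w).submatrix (Fin.last k).succAbove
        (Fin.last k).succAbove = (stdBasis k).toMatrix v := by
      ext i j
      simp [Module.Basis.toMatrix_apply, h]
    rw [h1]
    simp [Module.Basis.toMatrix_apply, mul_comm, ← two_mul]
  · intro j _
    simp [Module.Basis.toMatrix_apply, h0]

/-- The determinant of a family of `n` vectors of `ℝ^n` the first `n - 1` of which lie in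
`ℝ^{n-1}`. -/
theorem stdBasis_det_of_block {n : ℕ} (hn : 1 ≤ n) (w : Fin n → EuclideanSpace ℝ (Fin n))
    (v : Fin (n - 1) → EuclideanSpace ℝ (Fin (n - 1)))
    (h : ∀ (j : ℕ) (hj : j < n - 1), ∀ i < n - 1,
      coord (w ⟨j, by omega⟩) i = coord (v ⟨j, hj⟩) i)
    (h0 : ∀ (j : ℕ) (hj : j < n - 1), coord (w ⟨j, by omega⟩) (n - 1) = 0) :
    (stdBasis n).det w = (stdBasis (n - 1)).det v * coord (w ⟨n - 1, by omega⟩) (n - 1) := by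
  obtain ⟨k, rfl⟩ : ∃ k, n = k + 1 := ⟨n - 1, by omega⟩
  have h1 := stdBasis_det_succ w v
    (fun i j => by
      have h2 := h j j.2 i i.2
      rwa [coord_of_lt _ (show (i : ℕ) < k + 1 by omega),
        coord_of_lt _ (show (i : ℕ) < k + 1 - 1 from i.2)] at h2)
    (fun j => by
      have h2 := h0 j j.2
      rwa [coord_of_lt _ (show k + 1 - 1 < k + 1 by omega)] at h2)
  rw [coord_of_lt _ (show k + 1 - 1 < k + 1 by omega)]
  exact h1

variable {m n r : ℕ} {ε : ℕ → ℤˣ}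

/-- The determinant of the images of a frame of the singular set and a transverse vector `T` is, up
to the determinant of the frame, the product of the Jacobian of the restricted normal form and the
value of the conormal functional at `T`. -/
theorem stdBasis_det_fderiv_normalForm (hn : 1 ≤ n) (hnm : n ≤ m) {u : EuclideanSpace ℝ (Fin m)}
    (hu : IsCritical m n r ε u) (A : EuclideanSpace ℝ (Fin (n - 1)) →L[ℝ] EuclideanSpace ℝ (Fin m))
    (v : Fin (n - 1) → EuclideanSpace ℝ (Fin (n - 1))) (T : EuclideanSpace ℝ (Fin n)) :
    (stdBasis n).det (fun j : Fin n => if h : (j : ℕ) < n - 1 then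
        fderiv ℝ (normalForm m n r ε) u (A (v ⟨j, h⟩)) else T) =
      LinearMap.det ((resize m (n - 1)).comp A).toLinearMap * (stdBasis (n - 1)).det v *
        conormal m n r ε u T := by
  set w : Fin n → EuclideanSpace ℝ (Fin n) := fun j => if h : (j : ℕ) < n - 1 then
    fderiv ℝ (normalForm m n r ε) u (A (v ⟨j, h⟩)) else T with hw
  -- the shear of `ℝ^n` replacing the last coordinate by the conormal functional
  let S : EuclideanSpace ℝ (Fin n) →ₗ[ℝ] EuclideanSpace ℝ (Fin n) := LinearMap.transvection
    (-((fderiv ℝ (normalFormLast m n r ε) u).comp (pad m n)).toLinearMap) (lastVec n)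
  have hS : LinearMap.det S = 1 := by
    rw [LinearMap.transvection.det]
    simp [pad_lastVec]
  have hSapply : ∀ x, S x = x + (-fderiv ℝ (normalFormLast m n r ε) u (pad m n x)) • lastVec n :=
    fun x => by simp [S, LinearMap.transvection.apply]
  have hS1 : ∀ x, ∀ i < n - 1, coord (S x) i = coord x i := fun x i hi => by
    rw [hSapply, coord_add, coord_smul, coord_lastVec hi]
    ring
  have hS2 : ∀ x, coord (S x) (n - 1) = conormal m n r ε u x := fun x => by
    rw [hSapply, coord_add, coord_smul, coord_lastVec_last hn, conormal_apply]
    ring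
  have hwj : ∀ (j : ℕ) (hj : j < n - 1), w ⟨j, by omega⟩ =
      fderiv ℝ (normalForm m n r ε) u (A (v ⟨j, hj⟩)) := fun j hj => dif_pos hj
  have hwl : w ⟨n - 1, by omega⟩ = T := dif_neg (lt_irrefl _)
  have h1 : (stdBasis n).det w = (stdBasis n).det (S ∘ w) := by
    rw [Module.Basis.det_comp, hS, one_mul]
  rw [h1, stdBasis_det_of_block hn (S ∘ w) (((resize m (n - 1)).comp A).toLinearMap ∘ v),
    Module.Basis.det_comp]
  · simp only [Function.comp_apply]
    rw [hwl, hS2]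
  · intro j hj i hi
    simp only [Function.comp_apply]
    rw [hS1 _ i hi, hwj j hj, fderiv_normalForm, coord_add, coord_smul, coord_lastVec hi,
      coord_trunc hi]
    simp [coord_resize _ hi]
  · intro j hj
    simp only [Function.comp_apply]
    rw [hS2, hwj j hj, conormal_fderiv hn hnm hu]

end Determinant

/-! ### The singular set is closed -/

section Closed

variable {m n : ℕ}
  {M : Type*} [TopologicalSpace M] [ChartedSpace (EuclideanSpace ℝ (Fin m)) M]
  {N : Type*} [TopologicalSpace N] [ChartedSpace (EuclideanSpace ℝ (Fin n)) N] {f : M → N}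

theorem eventually_surjective {T : EuclideanSpace ℝ (Fin m) →L[ℝ] EuclideanSpace ℝ (Fin n)}
    (hT : Function.Surjective T) :
    ∀ᶠ T' : EuclideanSpace ℝ (Fin m) →L[ℝ] EuclideanSpace ℝ (Fin n) in 𝓝 T,
      Function.Surjective T' := by
  obtain ⟨R, hR⟩ := T.toLinearMap.exists_rightInverse_of_surjective
    (LinearMap.range_eq_top.2 hT)
  -- the determinant of `T' ∘ R` is `1` for `T' = T`, hence nonzero near `T`
  have h1 : Continuous fun T' : EuclideanSpace ℝ (Fin m) →L[ℝ] EuclideanSpace ℝ (Fin n) =>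
      (T'.comp (LinearMap.toContinuousLinearMap R)).det :=
    ContinuousLinearMap.continuous_det.comp (by fun_prop)
  have h2 : (T.comp (LinearMap.toContinuousLinearMap R)).det ≠ 0 := by
    have h3 : (T.comp (LinearMap.toContinuousLinearMap R)).toLinearMap = LinearMap.id := hR
    rw [ContinuousLinearMap.det, h3, LinearMap.det_id]
    exact one_ne_zero
  filter_upwards [h1.continuousAt.eventually_ne h2] with T' hT'
  have h4 := (LinearMap.equivOfDetNeZero _ hT').surjective
  exact Function.Surjective.of_comp (g := LinearMap.toContinuousLinearMap R) h4

theorem isClosed_singularSet [IsManifold (𝓡 m) ∞ M] [IsManifold (𝓡 n) ∞ N]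
    (hf : ContMDiff (𝓡 m) (𝓡 n) ∞ f) (hnm : n ≤ m) : IsClosed (singularSet m n f) := by
  rw [← isOpen_compl_iff, isOpen_iff_mem_nhds]
  intro x hx
  have hreg : ∀ y, y ∈ (singularSet m n f)ᶜ ↔
      Function.Surjective (mfderiv (𝓡 m) (𝓡 n) f y) := fun y => by
    rw [Set.mem_compl_iff, mem_singularSet_iff_not_surjective hnm, not_not]
  rw [hreg] at hx
  set φ := chartAt (EuclideanSpace ℝ (Fin m)) x
  set ψ := chartAt (EuclideanSpace ℝ (Fin n)) (f x)
  have hφ : φ ∈ IsManifold.maximalAtlas (𝓡 m) ∞ M := IsManifold.chart_mem_maximalAtlas x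
  have hψ : ψ ∈ IsManifold.maximalAtlas (𝓡 n) ∞ N := IsManifold.chart_mem_maximalAtlas (f x)
  have hxφ : x ∈ φ.source := mem_chart_source _ x
  have hxψ : f x ∈ ψ.source := mem_chart_source _ (f x)
  have hG : ∀ y ∈ φ.source, f y ∈ ψ.source →
      ContDiffAt ℝ ∞ (ψ ∘ f ∘ φ.symm) (φ y) := fun y hy hfy => by
    rw [← contMDiffAt_iff_contDiffAt]
    refine ContMDiffAt.comp (I' := 𝓡 n) _ ?_ (ContMDiffAt.comp (I' := 𝓡 m) _ hf.contMDiffAt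
      (contMDiffAt_symm_of_mem_maximalAtlas hφ (φ.map_source hy)))
    simp only [Function.comp_apply]
    rw [φ.left_inv hy]
    exact contMDiffAt_of_mem_maximalAtlas hψ hfy
  have hchain : ∀ y (hy : y ∈ φ.source) (hfy : f y ∈ ψ.source) v,
      chartDeriv hψ hfy (mfderiv (𝓡 m) (𝓡 n) f y v) =
        fderiv ℝ (ψ ∘ f ∘ φ.symm) (φ y) (chartDeriv hφ hy v) := fun y hy hfy v => by
    refine chartDeriv_mfderiv hφ hψ hy hfy (hf.mdifferentiable (by simp) y)
      ((hG y hy hfy).differentiableAt (by simp)) ?_ v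
    filter_upwards [φ.open_source.mem_nhds hy] with z hz
    simp [φ.left_inv hz]
  have hsurj : ∀ y (hy : y ∈ φ.source) (hfy : f y ∈ ψ.source),
      Function.Surjective (fderiv ℝ (ψ ∘ f ∘ φ.symm) (φ y)) ↔
        Function.Surjective (mfderiv (𝓡 m) (𝓡 n) f y) := fun y hy hfy =>
    (surjective_iff_of_conj (chartDeriv hφ hy).toEquiv (chartDeriv hψ hfy).toEquiv
      (hchain y hy hfy)).symm
  have hcont : ContinuousAt (fun y => fderiv ℝ (ψ ∘ f ∘ φ.symm) (φ y)) x :=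
    ContinuousAt.comp (f := φ) ((hG x hxφ hxψ).fderiv_right (m := 0) (by simp)).continuousAt
      (φ.continuousAt hxφ)
  filter_upwards [hcont.eventually (eventually_surjective ((hsurj x hxφ hxψ).2 hx)),
    φ.open_source.mem_nhds hxφ,
    hf.continuous.continuousAt.eventually (ψ.open_source.mem_nhds hxψ)] with y h1 h2 h3
  rw [hreg]
  exact (hsurj y h2 h3).1 h1

end Closed

/-! ### The canonical orientation in a slice chart -/

section CanonicalOrientation

variable {m n : ℕ}
  {M : Type*} [TopologicalSpace M] [ChartedSpace (EuclideanSpace ℝ (Fin m)) M]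
  {N : Type*} [TopologicalSpace N] [ChartedSpace (EuclideanSpace ℝ (Fin n)) N]
  {f : M → N} {r : ℕ} {x : M}
  {φ : OpenPartialHomeomorph M (EuclideanSpace ℝ (Fin m))}
  {ψ : OpenPartialHomeomorph N (EuclideanSpace ℝ (Fin n))} {ε : ℕ → ℤˣ}

variable (m n ε) in
/-- The sign which is `1` if the number of positive signs among `ε_1, …, ε_{m-n}` is even, and `-1`
otherwise. -/
def paritySign : ℝ := if Even (signCount m n ε) then 1 else -1

theorem paritySign_ne_zero : paritySign m n ε ≠ 0 := by
  unfold paritySign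
  split_ifs <;> norm_num

/-- The canonical coorientation as a sign rule: `λ`, the value of the conormal functional on a
vector in the canonical direction, and the second derivative `κ` of `Z` in the last variable have
the same sign up to the parity of the signs of the squares. -/
theorem IsNormalFormAt.mul_paritySign_pos (h : IsNormalFormAt f r x φ ψ ε)
    (hf : ContMDiff (𝓡 m) (𝓡 n) ∞ f) (hnm : n ≤ m) (heven : Even (m - n)) (hr : 1 ≤ r)
    (hrn : r ≤ n) {y : M} (hy : y ∈ φ.source) {c : Coorientation m n f y}
    (hc : IsCanonicalCoorientation f y c) {ν : TangentSpace (𝓡 n) (f y)}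
    (hν : PointsAlong f y c ν) (hκ : lastPartial₂ m n r ε (φ y) ≠ 0) :
    0 < conormal m n r ε (φ y) (chartDeriv h.target_chart (h.mapsTo hy) ν) *
      lastPartial₂ m n r ε (φ y) * paritySign m n ε := by
  obtain ⟨h0, h1⟩ := h.conormal_pos_iff hf hnm heven hr hrn hy hc hν
  rw [posIndex_eq (hr.trans hrn) hnm] at h1
  unfold paritySign
  rcases lt_or_gt_of_ne hκ with h2 | h2
  · rw [if_neg h2.not_gt, add_zero] at h1
    split_ifs with h3
    · have h4 := lt_of_le_of_ne (not_lt.1 fun h => (Nat.not_odd_iff_even.2 h3) (h1.1 h)) h0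
      nlinarith
    · have h4 := h1.2 (Nat.not_even_iff_odd.1 h3)
      nlinarith
  · rw [if_pos h2, Nat.odd_add_one, Nat.not_odd_iff_even] at h1
    split_ifs with h3
    · have h4 := h1.2 h3
      nlinarith
    · have h4 := lt_of_le_of_ne (not_lt.1 fun h => h3 (h1.1 h)) h0
      nlinarith

variable [ChartedSpace (EuclideanSpace ℝ (Fin (n - 1))) (singularSet m n f)]
  {σ : OpenPartialHomeomorph (singularSet m n f) (EuclideanSpace ℝ (Fin (n - 1)))}
  {s : EuclideanSpace ℝ (Fin (n - 1)) → EuclideanSpace ℝ (Fin m)}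

/-- The local form of the canonical orientation. In a slice chart `σ` of the singular set, with
parametrization `s`, the orientation with sign `τN * τ * paritySign` is canonical, where `τN` is the
sign of the orientation of `N` and `τ` is the common sign of the products `κ * δ`, with `κ` the
second derivative of `Z` in the last variable and `δ` the Jacobian of the restriction of `f` to the
singular set. Both `κ` and `δ` may change sign from one fold sheet to another, but they change sign
together. -/
theorem IsNormalFormAt.isCanonicallyOrientedAt (h : IsNormalFormAt f r x φ ψ ε)
    (hf : ContMDiff (𝓡 m) (𝓡 n) ∞ f) (hnm : n ≤ m) (heven : Even (m - n)) (hr : 1 ≤ r)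
    (hrn : r ≤ n)
    (hσ : σ ∈ IsManifold.maximalAtlas (𝓡 (n - 1)) ∞ (singularSet m n f))
    (hfS : ContMDiff (𝓡 (n - 1)) (𝓡 n) ∞ fun p : singularSet m n f => f p)
    (hs : ContDiff ℝ ∞ s) {y : singularSet m n f} (hyσ : y ∈ σ.source) (hy : (y : M) ∈ φ.source)
    (hev : ∀ᶠ z : singularSet m n f in 𝓝 y, φ z = s (σ z)) {τ τN : ℝ}
    (hτ : 0 < τ * (lastPartial₂ m n r ε (s (σ y)) *
      LinearMap.det (fderiv ℝ (fun w => resize m (n - 1) (s w)) (σ y)).toLinearMap))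
    {b₀ : Orientation ℝ (EuclideanSpace ℝ (Fin n)) (Fin n)}
    (hb₀ : ∀ w : Module.Basis (Fin n) ℝ (EuclideanSpace ℝ (Fin n)),
      w.orientation = b₀ ↔ 0 < τN * (stdBasis n).det w)
    {o₀ : Orientation ℝ (EuclideanSpace ℝ (Fin (n - 1))) (Fin (n - 1))}
    (ho₀ : ∀ v : Module.Basis (Fin (n - 1)) ℝ (EuclideanSpace ℝ (Fin (n - 1))),
      v.orientation = o₀ ↔ 0 < τN * τ * paritySign m n ε * (stdBasis (n - 1)).det v)
    {a : Orientation ℝ (TangentSpace (𝓡 (n - 1)) y) (Fin (n - 1))}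
    (ha : Orientation.map (Fin (n - 1)) (chartDeriv hσ hyσ) a = o₀)
    {b : Orientation ℝ (TangentSpace (𝓡 n) (f y)) (Fin n)}
    (hb : Orientation.map (Fin n) (chartDeriv h.target_chart (h.mapsTo hy)) b = b₀) :
    IsCanonicallyOrientedAt f y a b := by
  intro c hc ν hν v
  have hn : 1 ≤ n := hr.trans hrn
  have hu : IsCritical m n r ε (φ y) := (h.mem_singularSet_iff hf hn hnm hy).1 y.2
  have hφy : φ y = s (σ y) := hev.self_of_nhds
  rw [← hφy] at hτ
  have hκ : lastPartial₂ m n r ε (φ y) ≠ 0 := fun h0 => by simp [h0] at hτ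
  have hlam := h.mul_paritySign_pos hf hnm heven hr hrn hy hc hν hκ
  set A := chartDeriv hσ hyσ with hA
  set B := chartDeriv h.target_chart (h.mapsTo hy) with hB
  set κ := lastPartial₂ m n r ε (φ y)
  set lam := conormal m n r ε (φ y) (B ν)
  have hsd : Differentiable ℝ s := hs.differentiable (by simp)
  have hδ : fderiv ℝ (fun w => resize m (n - 1) (s w)) (σ y) =
      (resize m (n - 1)).comp (fderiv ℝ s (σ y)) :=
    ((resize m (n - 1)).hasFDerivAt.comp (σ y) (hsd (σ y)).hasFDerivAt).fderiv
  rw [hδ] at hτ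
  set δ := LinearMap.det ((resize m (n - 1)).comp (fderiv ℝ s (σ y))).toLinearMap
  -- the differential of `f` along the singular set, in charts
  have hchain : ∀ v, B (mfderiv (𝓡 (n - 1)) (𝓡 n) (fun p : singularSet m n f => f p) y v) =
      fderiv ℝ (normalForm m n r ε) (φ y) (fderiv ℝ s (σ y) (A v)) := by
    intro v
    have hNF : Differentiable ℝ (normalForm m n r ε) := contDiff_normalForm.differentiable
      (n := 1) (by simp)
    have h1 := chartDeriv_mfderiv (g := fun p : singularSet m n f => f p)
      (G := normalForm m n r ε ∘ s) hσ h.target_chart hyσ (h.mapsTo hy)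
      (hfS.mdifferentiable (by simp) y) ((hNF _).comp _ (hsd _)) (by
        filter_upwards [hev, (φ.open_source.preimage continuous_subtype_val).mem_nhds hy]
          with z hz hz'
        simp only [Function.comp_apply]
        rw [h.eq_normalForm _ hz', hz]) v
    rw [fderiv_comp _ (hNF _) (hsd _), ← hφy] at h1
    exact h1
  set w : Fin n → TangentSpace (𝓡 n) (f y) := fun j => if h : (j : ℕ) < n - 1 then
    mfderiv (𝓡 (n - 1)) (𝓡 n) (fun p : singularSet m n f => f p) y (v ⟨j, h⟩) else ν with hw
  have hBw : B ∘ w = fun j : Fin n => if h : (j : ℕ) < n - 1 then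
      fderiv ℝ (normalForm m n r ε) (φ y) (fderiv ℝ s (σ y) (A (v ⟨j, h⟩))) else B ν := by
    funext j
    simp only [Function.comp_apply, hw]
    split_ifs
    · exact hchain _
    · rfl
  have hdet : (stdBasis n).det (B ∘ w) = δ * (stdBasis (n - 1)).det (v.map A) * lam := by
    rw [hBw]
    exact stdBasis_det_fderiv_normalForm hn hnm hu (fderiv ℝ s (σ y)) (v.map A) (B ν)
  have hv0 : (stdBasis (n - 1)).det (v.map A) ≠ 0 := ((stdBasis (n - 1)).isUnit_det _).ne_zero
  have hδ0 : δ ≠ 0 := fun h0 => by simp [h0] at hτ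
  have hlam0 : lam ≠ 0 := fun h0 => by simp [h0] at hlam
  obtain ⟨hli, hsp⟩ := (Module.Basis.is_basis_iff_det (stdBasis n)).2
    (isUnit_iff_ne_zero.2 (hdet ▸ mul_ne_zero (mul_ne_zero hδ0 hv0) hlam0))
  let W : Module.Basis (Fin n) ℝ (EuclideanSpace ℝ (Fin n)) := Module.Basis.mk hli hsp.ge
  have hW : ⇑W = B ∘ w := Module.Basis.coe_mk hli hsp.ge
  have hmap : (W.map B.symm).map B = W := by ext; simp
  refine ⟨W.map B.symm, fun j => ?_, ?_⟩
  · rw [Module.Basis.map_apply, hW]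
    exact B.symm_apply_apply _
  · rw [basis_orientation_eq_iff h.target_chart (h.mapsTo hy) hb, ← hB, hmap,
      basis_orientation_eq_iff hσ hyσ ha, hb₀, ho₀, hW, hdet]
    -- eliminate `κ`, which has the sign of both `τ * δ` and `lam * paritySign m n ε`
    have key : 0 < δ * lam * (τ * paritySign m n ε) := by
      have h1 := mul_pos hτ hlam
      have h2 : 0 < κ ^ 2 * (δ * lam * (τ * paritySign m n ε)) := by
        convert! h1 using 1; ring
      exact (mul_pos_iff_of_pos_left (by positivity)).1 h2
    rw [show τN * (δ * (stdBasis (n - 1)).det (v.map A) * lam) =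
        τN * (stdBasis (n - 1)).det (v.map A) * (δ * lam) by ring,
      show τN * τ * paritySign m n ε * (stdBasis (n - 1)).det (v.map A) =
        τN * (stdBasis (n - 1)).det (v.map A) * (τ * paritySign m n ε) by ring]
    rcases pos_and_pos_or_neg_and_neg_of_mul_pos key with ⟨h1, h2⟩ | ⟨h1, h2⟩
    · rw [mul_pos_iff_of_pos_right h1, mul_pos_iff_of_pos_right h2]
    · rw [← neg_mul_neg, mul_pos_iff_of_pos_right (neg_pos.2 h1), ← neg_mul_neg _ (τ * _),
        mul_pos_iff_of_pos_right (neg_pos.2 h2)]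

/-- The canonical orientation of the tangent space at a fold point is unique. -/
theorem IsCanonicallyOrientedAt.eq {y : singularSet m n f}
    {a a' : Orientation ℝ (TangentSpace (𝓡 (n - 1)) y) (Fin (n - 1))}
    {b : Orientation ℝ (TangentSpace (𝓡 n) (f y)) (Fin n)}
    (ha : IsCanonicallyOrientedAt f y a b) (ha' : IsCanonicallyOrientedAt f y a' b)
    {c : Coorientation m n f y} (hc : IsCanonicalCoorientation f (y : M) c) : a = a' := by
  obtain ⟨ν, hν⟩ := exists_pointsAlong c
  let v : Module.Basis (Fin (n - 1)) ℝ (TangentSpace (𝓡 (n - 1)) y) := stdBasis (n - 1)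
  obtain ⟨w, hw, hwa⟩ := ha c hc ν hν v
  obtain ⟨w', hw', hwa'⟩ := ha' c hc ν hν v
  obtain rfl : w = w' := Module.Basis.eq_of_apply_eq fun j => (hw j).trans (hw' j).symm
  rw [hwa] at hwa'
  rcases v.orientation_eq_or_eq_neg a with h | h
  · rw [h]
    exact hwa'.1 h.symm
  · rcases v.orientation_eq_or_eq_neg a' with h' | h'
    · rw [h']
      exact (hwa'.2 h'.symm).symm
    · rw [h, h']

end CanonicalOrientation

/-! ### The singular set of a Morin map -/

section SingularSet

variable {m n : ℕ}
  {M : Type*} [TopologicalSpace M] [ChartedSpace (EuclideanSpace ℝ (Fin m)) M]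
  [IsManifold (𝓡 m) ∞ M]
  {N : Type*} [TopologicalSpace N] [ChartedSpace (EuclideanSpace ℝ (Fin n)) N]
  {f : M → N}

theorem IsNormalFormAt.isSliceChart {r : ℕ} {x : M}
    {φ : OpenPartialHomeomorph M (EuclideanSpace ℝ (Fin m))}
    {ψ : OpenPartialHomeomorph N (EuclideanSpace ℝ (Fin n))} {ε : ℕ → ℤˣ}
    (h : IsNormalFormAt f r x φ ψ ε) (hf : ContMDiff (𝓡 m) (𝓡 n) ∞ f) (hn : 1 ≤ n) (hnm : n ≤ m)
    {e : EuclideanSpace ℝ (Fin m) ≃ₜ EuclideanSpace ℝ (Fin m)} (he : ContDiff ℝ ∞ e)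
    (he' : ContDiff ℝ ∞ e.symm)
    (hcrit : ∀ u, IsCritical m n r ε u ↔ ∀ j, n - 1 ≤ j → coord (e u) j = 0) :
    IsSliceChart (n - 1) (singularSet m n f) (φ.transHomeomorph e) where
  mem_maximalAtlas := transHomeomorph_mem_maximalAtlas h.source_chart he he'
  mem_iff y hy := by
    rw [h.mem_singularSet_iff hf hn hnm hy, hcrit]
    rfl

/-- The singular set of a Morin map is a submanifold. Its charts can be chosen adapted to normal
forms of `f`: `s` is the parametrization of the singular set of the normal form that is inverse to
the chart `σ`. -/
theorem IsMorinMap.exists_chartedSpace_singularSet (hf : IsMorinMap m n f) (hnm : n ≤ m) :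
    ∃ _ : ChartedSpace (EuclideanSpace ℝ (Fin (n - 1))) (singularSet m n f),
      IsManifold (𝓡 (n - 1)) ∞ (singularSet m n f) ∧
      Manifold.IsSmoothEmbedding (𝓡 (n - 1)) (𝓡 m) ∞ (Subtype.val : singularSet m n f → M) ∧
      ∀ x : singularSet m n f, ∃ (r : ℕ) (φ : OpenPartialHomeomorph M (EuclideanSpace ℝ (Fin m)))
        (ψ : OpenPartialHomeomorph N (EuclideanSpace ℝ (Fin n))) (ε : ℕ → ℤˣ),
        IsNormalFormAt f r x φ ψ ε ∧ 1 ≤ r ∧ r ≤ n ∧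
        ∃ σ ∈ IsManifold.maximalAtlas (𝓡 (n - 1)) ∞ (singularSet m n f),
          σ.source = Subtype.val ⁻¹' φ.source ∧
          ∃ s : EuclideanSpace ℝ (Fin (n - 1)) → EuclideanSpace ℝ (Fin m), ContDiff ℝ ∞ s ∧
            (∀ y ∈ σ.source, φ y = s (σ y)) ∧ Dense {w | lastPartial₂ m n r ε (s w) ≠ 0} ∧
            ∃ τ : ℝ, τ ≠ 0 ∧ ∀ w, lastPartial₂ m n r ε (s w) ≠ 0 →
              0 < τ * (lastPartial₂ m n r ε (s w) *
                LinearMap.det (fderiv ℝ (fun w => resize m (n - 1) (s w)) w).toLinearMap) := by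
  have hloc : ∀ x ∈ singularSet m n f, ∃ (r : ℕ)
      (φ : OpenPartialHomeomorph M (EuclideanSpace ℝ (Fin m)))
      (ψ : OpenPartialHomeomorph N (EuclideanSpace ℝ (Fin n))) (ε : ℕ → ℤˣ),
      IsNormalFormAt f r x φ ψ ε ∧ 1 ≤ r ∧ r ≤ n := fun x hx => by
      obtain ⟨r, hr, hrn, φ, ψ, ε, h⟩ := hf.2 x hx
      exact ⟨r, φ, ψ, ε, h, hr, hrn⟩
  obtain ⟨cs, hman, hemb, hcharts⟩ := exists_isSmoothEmbedding_of_isSliceChart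
    (S := singularSet m n f) (show n - 1 ≤ m by omega) fun x hx => by
      obtain ⟨r, φ, ψ, ε, h, hr, hrn⟩ := hloc x hx
      obtain ⟨e, he, he', hcrit, -⟩ := exists_straightening hr hrn hnm ε
      exact ⟨_, h.isSliceChart hf.1 (hr.trans hrn) hnm he he' hcrit, h.mem_source⟩
  refine ⟨cs, hman, hemb, fun x => ?_⟩
  obtain ⟨r, φ, ψ, ε, h, hr, hrn⟩ := hloc x x.2
  obtain ⟨e, he, he', hcrit, hdense, τ, hτ, hsign⟩ := exists_straightening hr hrn hnm ε
  have hsl := h.isSliceChart hf.1 (hr.trans hrn) hnm he he' hcrit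
  obtain ⟨σ, hσ, hσs, hσe⟩ := hcharts _ hsl x h.mem_source
  refine ⟨r, φ, ψ, ε, h, hr, hrn, σ, hσ, hσs, fun w => e.symm (resize (n - 1) m w),
    he'.comp (resize (n - 1) m).contDiff, fun y hy => ?_, hdense, τ, hτ, hsign⟩
  rw [hσs] at hy
  beta_reduce
  rw [hσe, resize_resize_of_forall_coord_eq_zero ((hsl.mem_iff y hy).1 y.2)]
  exact (e.symm_apply_apply _).symm

end SingularSet

end MorinMap

end

theorem mainTheorem8 {m n : ℕ} (hnm : n ≤ m) (heven : Even (m - n))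
    {M : Type*} [TopologicalSpace M] [ChartedSpace (EuclideanSpace ℝ (Fin m)) M]
    [IsManifold (𝓡 m) ∞ M]
    {N : Type*} [TopologicalSpace N] [ChartedSpace (EuclideanSpace ℝ (Fin n)) N]
    [IsManifold (𝓡 n) ∞ N]
    (oN : ∀ y : N, Orientation ℝ (TangentSpace (𝓡 n) y) (Fin n))
    (hoN : MorinMap.IsOrientation oN)
    (f : M → N) (hf : MorinMap.IsMorinMap m n f) :
    -- every fold point has a unique canonical coorientation
    (∀ x ∈ MorinMap.singularType m n 1 f,
      ∃! c : MorinMap.Coorientation m n f x, MorinMap.IsCanonicalCoorientation f x c) ∧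
    -- the singular set is a closed embedded smooth submanifold of dimension `n - 1`
    IsClosed (MorinMap.singularSet m n f) ∧
    ∃ _ : ChartedSpace (EuclideanSpace ℝ (Fin (n - 1))) (MorinMap.singularSet m n f),
      IsManifold (𝓡 (n - 1)) ∞ (MorinMap.singularSet m n f) ∧
      Manifold.IsSmoothEmbedding (𝓡 (n - 1)) (𝓡 m) ∞
        (Subtype.val : MorinMap.singularSet m n f → M) ∧
      -- the orientation of the fold locus given by the canonical coorientation extends to a unique
      -- orientation of the whole singular set
      ∃! oS : ∀ x : MorinMap.singularSet m n f,
          Orientation ℝ (TangentSpace (𝓡 (n - 1)) x) (Fin (n - 1)),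
        MorinMap.IsOrientation oS ∧
        ∀ x : MorinMap.singularSet m n f, (x : M) ∈ MorinMap.singularType m n 1 f →
          MorinMap.IsCanonicallyOrientedAt f x (oS x) (oN (f x)) := by
  refine ⟨fun x hx => MorinMap.existsUnique_canonicalCoorientation hf.1 hnm heven hx,
    MorinMap.isClosed_singularSet hf.1 hnm, ?_⟩
  obtain ⟨cs, hman, hemb, hcharts⟩ := hf.exists_chartedSpace_singularSet hnm
  refine ⟨cs, hman, hemb, MorinMap.existsUnique_isOrientation
    (D := {y : MorinMap.singularSet m n f | (y : M) ∈ MorinMap.singularType m n 1 f})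
    (C := fun y a => MorinMap.IsCanonicallyOrientedAt f y a (oN (f y))) (fun x => ?_)
    (fun y hy a a' ha ha' => ?_) fun x => ?_⟩
  · -- the fold points are dense in the singular set
    obtain ⟨r, φ, ψ, ε, h, hr, hrn, σ, hσ, hσs, s, hs, hφs, hdense, -⟩ := hcharts x
    have hx : x ∈ σ.source := hσs ▸ h.mem_source
    refine mem_closure_iff_nhds.2 fun t ht => ?_
    have h1 : σ.symm ⁻¹' t ∈ 𝓝 (σ x) :=
      (σ.continuousAt_symm (σ.map_source hx)).preimage_mem_nhds (by rwa [σ.left_inv hx])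
    obtain ⟨w, ⟨hwt, hwσ⟩, hw⟩ := mem_closure_iff_nhds.1 (hdense (σ x)) _
      (Filter.inter_mem h1 (σ.open_target.mem_nhds (σ.map_source hx)))
    have hy := σ.map_target hwσ
    have hyφ : (σ.symm w : M) ∈ φ.source := by
      rw [hσs] at hy
      exact hy
    refine ⟨σ.symm w, hwt, (h.mem_singularType_one_iff hf hnm hr hrn hyφ (σ.symm w).2).2 ?_⟩
    rwa [hφs _ hy, σ.right_inv hwσ]
  · -- the compatibility condition determines the orientation at a fold point
    obtain ⟨c, hc, -⟩ := MorinMap.existsUnique_canonicalCoorientation hf.1 hnm heven hy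
    exact ha.eq ha' hc
  · -- in an adapted chart the orientation with sign `τN * τ * paritySign m n ε` is compatible
    obtain ⟨r, φ, ψ, ε, h, hr, hrn, σ, hσ, hσs, s, hs, hφs, -, τ, hτ, hsign⟩ := hcharts x
    have hfS : ContMDiff (𝓡 (n - 1)) (𝓡 n) ∞ fun p : MorinMap.singularSet m n f => f p :=
      hf.1.comp hemb.contMDiff
    obtain ⟨b₀, hb₀⟩ := hoN.eventually_map_eq h.target_chart h.map_mem_source
    obtain ⟨τN, hτN, hb₀'⟩ := MorinMap.exists_sign_of_orientation b₀
    obtain ⟨o₀, ho₀⟩ := MorinMap.exists_orientation_of_sign (d := n - 1)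
      (mul_ne_zero (mul_ne_zero hτN hτ) (MorinMap.paritySign_ne_zero (m := m) (n := n) (ε := ε)))
    refine ⟨σ, hσ, hσs ▸ h.mem_source, o₀, ?_⟩
    filter_upwards [hfS.continuous.continuousAt.eventually hb₀] with y hby hyσ hyD a ha
    have hy : (y : M) ∈ φ.source := by
      rw [hσs] at hyσ
      exact hyσ
    have hκ := (h.mem_singularType_one_iff hf hnm hr hrn hy y.2).1 hyD
    rw [hφs y hyσ] at hκ
    exact h.isCanonicallyOrientedAt hf.1 hnm heven hr hrn hσ hfS hs hyσ hy
      (Filter.eventually_of_mem (σ.open_source.mem_nhds hyσ) hφs) (hsign _ hκ) hb₀' ho₀ ha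
      (hby (h.mapsTo hy))
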